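/- **Theorem (Züst integral).** *Notation.* Let $D\subseteq\mathbb R^d$ be any set. A $k$-simplex in $D$ is an ordered tuple $S=[p_0\dots p_k]$ of points of $D$ with $\operatorname{conv}\{p_0,\dots,p_k\}\subseteq D$, and a $k$-germ in $D$ is a function $\omega$ from $k$-simplices in $D$ to $\mathbb R$, $S\mapsto\omega_S$; so $0$-germs are functions on $D$. Put $(\delta\omega)_{p_0\dots p_{k+1}}=\sum_{i=0}^{k+1}(-1)^i\omega_{p_0\dots\hat p_i\dots p_{k+1}}$ and $(\omega\cup\eta)_{p_0\dots p_{k+h}}=\omega_{p_0\dots p_k}\,\eta_{p_k\dots p_{k+h}}$. A $k$-gauge is a $k$-germ $v\ge 0$; $[\omega]_v\in[0,\infty]$ is the infimum of the constants $c\ge 0$ with $|\omega|\le c\,v$, and $[\omega]_\gamma:=[\omega]_{\operatorname{diam}^\gamma}$, where $\operatorname{diam}[p_0\dots p_k]=\max_{i,j}|p_i-p_j|$. The gauge $v$ is $k$-Dini if $v_S=v_{S'}$ whenever an isometry of $\mathbb R^d$ maps the vertices of $S$ to those of $S'$ in order, and $\lim_{n\to\infty} 2^{nk}v_{S_n}=0$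 for every $k$-simplex $S=[p_0\dots p_k]$ in $D$, where $S_n$ has vertices $p_0+2^{-n}(p_i-p_0)$. A $k$-germ $\omega$ is *regular* if $\omega_S=0$ whenever $S$ has zero $k$-dimensional volume and if, for every $I\subseteq\mathbb R^k$ and every affine $\varphi$ mapping $I$ into $D$, the germ $[p_0\dots p_k]\mapsto\omega_{\varphi(p_0)\dots\varphi(p_k)}$ in $I$ satisfies $\delta(\cdot)=0$. For a $k$-Dini gauge $v$, a $k$-germ $\omega$ is *$v$-sewable* if there is a regular $k$-germ, denoted $\operatorname{sew}\omega$, with $[\omega-\operatorname{sew}\omega]_v<\infty$; *$\gamma$-sewable* means $\operatorname{diam}^\gamma$-sewable, and *sewable* means $v$-sewable for some $k$-Dini gauge $v$. For a $0$-germ $f$ and a germ $\eta$ such that $f\cup\delta\eta$ is sewable, $f\,\mathrm d\eta:=\operatorname{sew}(f\cup\delta\eta)$. *Statement.* Let $\alpha>0$ and $\beta>1$ with $\gamma:=\alpha+\beta>2$. There is a constant $C=C(\alpha,\beta)$ such that the following holds for every $d$, every $D\subseteq\mathbb R^d$ and all continuous $f,g^1,g^2\colon D\to\mathbb R$ with $$[\delta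 f]_\alpha+[\delta g^1\cup\delta g^2]_\beta<\infty .$$ The $1$-germ $g^1\cup\delta g^2$ is sewable, with a unique regular germ $\operatorname{sew}(g^1\cup\delta g^2)=:g^1\,\mathrm dg^2$ (unique also among all choices of the $1$-Dini gauge). The $2$-germ $f\cup\delta(g^1\,\mathrm dg^2)$ is $\gamma$-sewable, with a unique regular germ $\operatorname{sew}\bigl(f\cup\delta(g^1\,\mathrm dg^2)\bigr)$ (unique also among all choices of the $2$-Dini gauge), which defines $$f\,\mathrm dg^1\wedge\mathrm dg^2:=f\,\mathrm d(g^1\,\mathrm dg^2)=\operatorname{sew}\bigl(f\cup\delta(g^1\,\mathrm dg^2)\bigr),$$ and $$\bigl[f\cup\delta(g^1\,\mathrm dg^2)-f\,\mathrm dg^1\wedge\mathrm dg^2\bigr]_\gamma\le C\,[\delta f]_\alpha\,[\delta g^1\cup\delta g^2]_\beta .$$ -/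

import Mathlib

open scoped NNReal ENNReal

noncomputable section

namespace RoughForm

/-- The Euclidean space `ℝ^d`. -/
abbrev E (d : ℕ) : Type := EuclideanSpace ℝ (Fin d)

variable {d : ℕ} {D : Set (E d)}

/-- `k`-simplices `[p₀ … p_k]` in `D`: ordered tuples of points whose convex envelope lies in `D`. -/
abbrev Simp (D : Set (E d)) (k : ℕ) : Type :=
  {p : Fin (k + 1) → E d // convexHull ℝ (Set.range p) ⊆ D}

/-- The simplex `[p_{φ 0} … p_{φ m}]` on some of the vertices of `S = [p₀ … p_k]`. -/
def Simp.sub {k m : ℕ} (S : Simp D k) (φ : Fin (m + 1) → Fin (k + 1)) : Simp D m :=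
  ⟨fun i => S.1 (φ i),
    (convexHull_mono (Set.range_comp_subset_range φ S.1)).trans S.2⟩

/-- The push-forward of a simplex by an affine map which maps `I` into `D`. -/
def Simp.map {n k : ℕ} {I : Set (E n)} (φ : E n →ᵃ[ℝ] E d) (h : Set.MapsTo φ I D)
    (S : Simp I k) : Simp D k :=
  ⟨fun i => φ (S.1 i), by
    have e : Set.range (fun i => φ (S.1 i)) = φ '' Set.range S.1 := Set.range_comp φ S.1
    rw [e, ← AffineMap.image_convexHull]
    exact (Set.image_mono S.2).trans h.image_subset⟩

/-- The translated copy, based at `p₀`, of the rescaled simplex `2^{-n} S`: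
its vertices are `p₀ + 2^{-n} (p_i - p₀)`. It always lies in `D`. -/
def Simp.shrink {k : ℕ} (n : ℕ) (S : Simp D k) : Simp D k :=
  ⟨fun i => S.1 0 + ((1 / 2 : ℝ) ^ n) • (S.1 i - S.1 0), by
    refine (convexHull_min ?_ (convex_convexHull ℝ (Set.range S.1))).trans S.2
    rintro _ ⟨i, rfl⟩
    exact (convex_convexHull ℝ (Set.range S.1)).add_smul_sub_mem
      (subset_convexHull ℝ _ ⟨0, rfl⟩) (subset_convexHull ℝ _ ⟨i, rfl⟩)
      ⟨by positivity, pow_le_one₀ (by norm_num) (by norm_num)⟩⟩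

/-- Two `k`-simplices are isometric if an isometry of `ℝ^d` maps the vertices of the first one
to those of the second one, in the given order. -/
def Simp.Isometric {k : ℕ} (S T : Simp D k) : Prop :=
  ∃ ι : E d → E d, Isometry ι ∧ ∀ j, ι (S.1 j) = T.1 j

/-- The diameter of a simplex, i.e. the largest distance between two of its vertices. -/
def Simp.diam {k : ℕ} (S : Simp D k) : ℝ := Metric.diam (Set.range S.1)

/-- The `k`-volume of a `k`-simplex, `(1 / k!) √(det (P Pᵀ))`, where the rows of `P` are
the vectors `p_i - p₀`, `i = 1, …, k`. -/
def Simp.vol {k : ℕ} (S : Simp D k) : ℝ :=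
  let P : Matrix (Fin k) (Fin d) ℝ := Matrix.of fun i j => (S.1 i.succ - S.1 0) j
  (1 / (k.factorial : ℝ)) * Real.sqrt (P * P.transpose).det

/-- `k`-germs in `D`: real functions of `k`-simplices. A `0`-germ is a real function on `D`. -/
abbrev Germ (D : Set (E d)) (k : ℕ) : Type := Simp D k → ℝ

/-- The exterior derivative `⟨[p₀ … p_{k+1}], δω⟩ = ∑ᵢ (-1)^i ⟨[p₀ … p̂ᵢ … p_{k+1}], ω⟩`. -/
def delta {k : ℕ} (ω : Germ D k) : Germ D (k + 1) :=
  fun S => ∑ i : Fin (k + 2), (-1 : ℝ) ^ (i : ℕ) * ω (S.sub i.succAbove)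

/-- The cup product `⟨[p₀ … p_{k+h}], ω ∪ η⟩ = ⟨[p₀ … p_k], ω⟩ ⟨[p_k … p_{k+h}], η⟩`.
The degree is written `h + k`, so that it is definitionally `h` if `ω` is a `0`-germ. -/
def cup {k h : ℕ} (ω : Germ D k) (η : Germ D h) : Germ D (h + k) :=
  fun S =>
    ω (S.sub fun i : Fin (k + 1) => ⟨(i : ℕ), by omega⟩) *
    η (S.sub fun i : Fin (h + 1) => ⟨k + (i : ℕ), by omega⟩)

/-- The pull-back of a germ by an affine map which maps `I` into `D`. -/
def pullback {n k : ℕ} {I : Set (E n)} (φ : E n →ᵃ[ℝ] E d) (h : Set.MapsTo φ I D)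
    (ω : Germ D k) : Germ I k :=
  fun S => ω (S.map φ h)

/-- `[ω]_v ∈ [0, ∞]`, the infimum of all constants `c ≥ 0` with `|ω| ≤ c v`. -/
def bracket {k : ℕ} (v ω : Germ D k) : ℝ≥0∞ :=
  ⨅ (c : ℝ≥0) (_ : ∀ S : Simp D k, |ω S| ≤ (c : ℝ) * v S), (c : ℝ≥0∞)

/-- The gauge `diam^γ` on `k`-simplices. -/
def diamPow (D : Set (E d)) (k : ℕ) (γ : ℝ) : Germ D k := fun S => S.diam ^ γ

/-- `[ω]_γ`, the bracket with respect to the gauge `diam^γ`. -/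
def bracketPow {k : ℕ} (γ : ℝ) (ω : Germ D k) : ℝ≥0∞ := bracket (diamPow D k γ) ω

/-- An `r`-Dini gauge: a nonnegative germ `v`, equal on isometric simplices, such that
`2^{nr} ⟨2^{-n} S, v⟩ → 0` for all simplices `S` in `D`. -/
structure IsDiniGauge {k : ℕ} (r : ℝ) (v : Germ D k) : Prop where
  nonneg : ∀ S, 0 ≤ v S
  uniform : ∀ S T : Simp D k, S.Isometric T → v S = v T
  tendsto_zero : ∀ S : Simp D k,
    Filter.Tendsto (fun n : ℕ => (2 : ℝ) ^ ((n : ℝ) * r) * v (S.shrink n)) Filter.atTop (nhds 0)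

/-- Nonatomic germs vanish on simplices of zero volume. -/
def IsNonatomic {k : ℕ} (ω : Germ D k) : Prop := ∀ S : Simp D k, S.vol = 0 → ω S = 0

/-- Germs that are closed on `k`-planes: all their affine pull-backs to subsets of `ℝ^k`
are closed. -/
def IsClosedOnPlanes {k : ℕ} (ω : Germ D k) : Prop :=
  ∀ (I : Set (E k)) (φ : E k →ᵃ[ℝ] E d) (h : Set.MapsTo φ I D), delta (pullback φ h ω) = 0

/-- Regular germs. -/
def IsRegular {k : ℕ} (ω : Germ D k) : Prop := IsNonatomic ω ∧ IsClosedOnPlanes ω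

/-- `ω` is `v`-sewable: `v` is a `k`-Dini gauge, and some regular germ `η` satisfies
`[ω - η]_v < ∞`. -/
def IsSewableWith {k : ℕ} (v ω : Germ D k) : Prop :=
  IsDiniGauge k v ∧ ∃ η : Germ D k, IsRegular η ∧ bracket v (ω - η) < ∞

/-- `η` is a regularization of `ω`: it is regular, and `[ω - η]_v < ∞` for some `k`-Dini
gauge `v`. -/
def IsSew {k : ℕ} (ω η : Germ D k) : Prop :=
  IsRegular η ∧ ∃ v : Germ D k, IsDiniGauge k v ∧ bracket v (ω - η) < ∞

open Classical in
/-- The regular germ `sew ω` of a sewable germ `ω` (with value `0` if `ω` is not sewable). -/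
def sew {k : ℕ} (ω : Germ D k) : Germ D k :=
  if h : ∃ η, IsSew ω η then h.choose else 0

/-- `f dη := sew (f ∪ δη)`, for a `0`-germ `f`. -/
def sewD {k : ℕ} (f : Germ D 0) (η : Germ D k) : Germ D (k + 1) :=
  sew (cup (k := 0) (h := k + 1) f (delta η))

end RoughForm

end

open RoughForm

/-! The proof sews twice, along segments and then along triangles. Suppose that cutting a simplex
into `M` pieces of half its size changes a function of simplices by at most a constant times the
size to the power `γ`, with `M < 2 ^ γ`. Then the sums over iterated subdivisions converge to an
invariant function, close to the given one to order `γ`; and an invariant function of order `γ`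
vanishes (`IsSubdivision.eq_zero`). With `M = 2` and exponent `β > 1` this applies to `g₁ ∪ δg₂`,
whose coboundary is `δg₁ ∪ δg₂`. With `M = 4` and exponent `α + β > 2` it applies to `f ∪ δη`, where
`η` is the sewn 1-germ: `δη` is exactly additive, so the only defect is the change of the point at
which `f` is evaluated.

Midpoint subdivision gives only dyadic invariance, whereas regularity asks for additivity under
arbitrary cuts. The missing identities all rest on one device: the difference of the two sides is
invariant under subdivision and small of the right order, hence zero. On segments this gives
antisymmetry and additivity over `N` equal parts, then over any cut by continuity. On triangles it
gives alternation, vanishing on lines, and the exchange of the diagonal of a parallelogram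
(`sewTri_flip`). The exchange makes the values on a strip of parallelograms a closed function on a
grid; path independence of its potential shows that the sum over a fan with `N` equal bases is again
invariant under midline subdivision (`triSum_sum_sewTri`). Hence additivity over fans, over any cut
from a vertex, and by Radon's theorem closedness on planes.

For uniqueness, the difference of two candidates is regular, hence additive under midline
subdivision. After `n` steps there are `2 ^ (n * k)` pieces isometric to `2 ^ (-n) S`, and the Dini
condition forces the value `0`. Since `D` need not be convex, the estimates are made on convex `K ⊆
D`, eventually the hull of a single simplex, with constants independent of `K`. -/

namespace RoughForm

section

open Filter Topology

/-! ### Sewing for an abstract subdivision. -/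

section Refinement

variable {X ι : Type*} [Fintype ι]

/-- The sum of `ω` over the pieces `s i x` of `x`. -/
def refine (s : ι → X → X) (ω : X → ℝ) : X → ℝ := fun x => ∑ i, ω (s i x)

/-- The limit of the sums of `ω` over successive refinements. -/
noncomputable def refineLim (s : ι → X → X) (ω : X → ℝ) : X → ℝ :=
  fun x => limUnder atTop fun n : ℕ => (refine s)^[n] ω x

/-- The pieces of an element of `P` belong to `P` and have at most half its size. -/
structure IsSubdivision (s : ι → X → X) (P : Set X) (ρ : X → ℝ) : Prop where
  mem : ∀ i, ∀ x ∈ P, s i x ∈ P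
  size_nonneg : ∀ x, 0 ≤ ρ x
  size_le : ∀ i, ∀ x ∈ P, ρ (s i x) ≤ ρ x / 2

theorem refine_iterate_sub (s : ι → X → X) (ω η : X → ℝ) (n : ℕ) :
    (refine s)^[n] (ω - η) = (refine s)^[n] ω - (refine s)^[n] η := by
  induction n generalizing ω η with
  | zero => rfl
  | succ n ih =>
    have h : refine s (ω - η) = refine s ω - refine s η := by
      funext x
      simp [refine]
    simp only [Function.iterate_succ_apply, h, ih]

/-- The sets `Q n` record what is known of pieces of depth `n`, so that `ω` is bounded at a single
depth. This covers bounds by a power of the size as well as bounds by a Dini gauge, where all pieces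
of one depth must be isometric. -/
theorem abs_refine_iterate_le {s : ι → X → X} {Q : ℕ → Set X}
    (hQ : ∀ n i, ∀ x ∈ Q n, s i x ∈ Q (n + 1)) {ω : X → ℝ} {w : ℝ} (n m : ℕ)
    (hw : ∀ x ∈ Q (m + n), |ω x| ≤ w) {x : X} (hx : x ∈ Q m) :
    |(refine s)^[n] ω x| ≤ (Fintype.card ι : ℝ) ^ n * w := by
  induction n generalizing m x with
  | zero => simpa using hw x hx
  | succ n ih =>
    rw [Function.iterate_succ_apply']
    refine (Finset.abs_sum_le_sum_abs _ _).trans ?_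
    refine (Finset.sum_le_sum fun i _ =>
      ih (m + 1) (fun y hy => hw y (by convert hy using 2; omega)) (hQ m i x hx)).trans ?_
    simp [pow_succ]
    exact le_of_eq (by ring)

theorem refine_iterate_eq_of_refine_eq {s : ι → X → X} {P : Set X}
    (hP : ∀ i, ∀ x ∈ P, s i x ∈ P) {G : X → ℝ} (hG : ∀ x ∈ P, refine s G x = G x)
    (n : ℕ) {x : X} (hx : x ∈ P) : (refine s)^[n] G x = G x := by
  induction n generalizing x with
  | zero => rfl
  | succ n ih =>
    rw [Function.iterate_succ_apply', ← hG x hx]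
    exact Finset.sum_congr rfl fun i _ => ih (hP i x hx)

variable {s : ι → X → X} {P : Set X} {ρ : X → ℝ}

theorem IsSubdivision.abs_refine_iterate_le (hs : IsSubdivision s P ρ) {γ c : ℝ} (hγ : 0 ≤ γ)
    (hc : 0 ≤ c) {ω : X → ℝ} (hω : ∀ x ∈ P, |ω x| ≤ c * ρ x ^ γ) (n : ℕ) {x : X} (hx : x ∈ P) :
    |(refine s)^[n] ω x| ≤ c * ρ x ^ γ * (Fintype.card ι / (2 : ℝ) ^ γ) ^ n := by
  have key := RoughForm.abs_refine_iterate_le (s := s) (ω := ω)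
    (Q := fun k => {y | y ∈ P ∧ ρ y ≤ ρ x / 2 ^ k}) (w := c * (ρ x / 2 ^ n) ^ γ)
    (fun k i y hy => ⟨hs.mem i y hy.1, (hs.size_le i y hy.1).trans (by
      have := hy.2
      rw [pow_succ, ← div_div]
      linarith)⟩) n 0
    (fun y hy => (hω y hy.1).trans (by
      have := hs.size_nonneg y
      have h2 := hy.2
      rw [zero_add] at h2
      gcongr)) (x := x) ⟨hx, by simp⟩
  refine key.trans (le_of_eq ?_)
  rw [Real.div_rpow (hs.size_nonneg x) (by positivity), div_pow, ← Real.rpow_natCast 2 n,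
    ← Real.rpow_natCast _ n, ← Real.rpow_natCast _ n, ← Real.rpow_mul (by norm_num),
    ← Real.rpow_mul (by norm_num), mul_comm (n : ℝ) γ]
  ring

/-- `G x` equals its sum over `card ι ^ n` pieces of size at most `ρ x / 2 ^ n`, and these sums tend
to `0`. The exact identities for sewn functions come from here. -/
theorem IsSubdivision.eq_zero (hs : IsSubdivision s P ρ) {γ c : ℝ} (hγ : 0 ≤ γ)
    (hcard : (Fintype.card ι : ℝ) < (2 : ℝ) ^ γ) {G : X → ℝ}
    (hG : ∀ x ∈ P, refine s G x = G x) (hGc : ∀ x ∈ P, |G x| ≤ c * ρ x ^ γ) {x : X}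
    (hx : x ∈ P) : G x = 0 := by
  have h2 : (0 : ℝ) < 2 ^ γ := by positivity
  have hG' : ∀ x ∈ P, |G x| ≤ |c| * ρ x ^ γ := fun y hy =>
    (hGc y hy).trans (mul_le_mul_of_nonneg_right (le_abs_self c)
      (Real.rpow_nonneg (hs.size_nonneg y) γ))
  have lim : Tendsto (fun n : ℕ => |c| * ρ x ^ γ * (Fintype.card ι / (2 : ℝ) ^ γ) ^ n) atTop
      (𝓝 (|c| * ρ x ^ γ * 0)) :=
    (tendsto_pow_atTop_nhds_zero_of_lt_one (by positivity) ((div_lt_one h2).2 hcard)).const_mul _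
  rw [mul_zero] at lim
  have : |G x| ≤ 0 := ge_of_tendsto' lim fun n => by
    rw [← refine_iterate_eq_of_refine_eq hs.mem hG n hx]
    exact hs.abs_refine_iterate_le hγ (abs_nonneg c) hG' n hx
  exact abs_nonpos_iff.1 this

/-- The constant in the sewing lemma for a subdivision in `M` pieces. -/
noncomputable def sewConst (M : ℕ) (γ : ℝ) : ℝ := 1 / (1 - M / (2 : ℝ) ^ γ)

theorem sewConst_nonneg {M : ℕ} {γ : ℝ} (h : (M : ℝ) < 2 ^ γ) : 0 ≤ sewConst M γ := by
  have : (M : ℝ) / 2 ^ γ < 1 := (div_lt_one (by positivity)).2 h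
  exact one_div_nonneg.2 (by linarith)

/-- `ω` is additive with respect to `s`, up to an error of order `γ`. -/
structure IsAlmostAdditive (s : ι → X → X) (P : Set X) (ρ : X → ℝ) (γ c : ℝ) (ω : X → ℝ) :
    Prop where
  subdiv : IsSubdivision s P ρ
  exponent_nonneg : 0 ≤ γ
  card_lt : (Fintype.card ι : ℝ) < (2 : ℝ) ^ γ
  const_nonneg : 0 ≤ c
  le : ∀ x ∈ P, |ω x - refine s ω x| ≤ c * ρ x ^ γ

namespace IsAlmostAdditive

variable {γ c : ℝ} {ω : X → ℝ} (h : IsAlmostAdditive s P ρ γ c ω)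
include h

theorem dist_le (n : ℕ) {x : X} (hx : x ∈ P) :
    dist ((refine s)^[n] ω x) ((refine s)^[n + 1] ω x) ≤
      c * ρ x ^ γ * (Fintype.card ι / (2 : ℝ) ^ γ) ^ n := by
  have := h.subdiv.abs_refine_iterate_le h.exponent_nonneg h.const_nonneg
    (ω := ω - refine s ω) h.le n hx
  rwa [refine_iterate_sub, ← Function.iterate_succ_apply] at this

theorem ratio_lt_one : (Fintype.card ι : ℝ) / (2 : ℝ) ^ γ < 1 :=
  (div_lt_one (by positivity)).2 h.card_lt

theorem tendsto_refineLim {x : X} (hx : x ∈ P) :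
    Tendsto (fun n : ℕ => (refine s)^[n] ω x) atTop (𝓝 (refineLim s ω x)) :=
  (cauchySeq_of_le_geometric _ _ h.ratio_lt_one fun n => h.dist_le n hx).tendsto_limUnder

theorem dist_refineLim_le (n : ℕ) {x : X} (hx : x ∈ P) :
    dist ((refine s)^[n] ω x) (refineLim s ω x) ≤
      c * ρ x ^ γ * (Fintype.card ι / (2 : ℝ) ^ γ) ^ n * sewConst (Fintype.card ι) γ := by
  have := dist_le_of_le_geometric_of_tendsto _ _ h.ratio_lt_one
    (fun n => h.dist_le n hx) (h.tendsto_refineLim hx) n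
  rwa [div_eq_mul_one_div] at this

theorem abs_sub_refineLim_le {x : X} (hx : x ∈ P) :
    |ω x - refineLim s ω x| ≤ c * ρ x ^ γ * sewConst (Fintype.card ι) γ := by
  simpa [Real.dist_eq] using h.dist_refineLim_le 0 hx

theorem refine_refineLim {x : X} (hx : x ∈ P) :
    refine s (refineLim s ω) x = refineLim s ω x := by
  have h1 : Tendsto (fun n : ℕ => (refine s)^[n + 1] ω x) atTop
      (𝓝 (refine s (refineLim s ω) x)) := by
    simp only [Function.iterate_succ_apply']
    exact tendsto_finsetSum _ fun i _ => h.tendsto_refineLim (h.subdiv.mem i x hx)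
  exact tendsto_nhds_unique h1 ((tendsto_add_atTop_iff_nat 1).2 (h.tendsto_refineLim hx))

/-- The geometric error bound depends on the point only through `ρ`, which is locally bounded, so
the convergence is locally uniform. -/
theorem continuousOn_refineLim [TopologicalSpace X] (hs : ∀ i, ContinuousOn (s i) P)
    (hρ : Continuous ρ) (hω : ContinuousOn ω P) : ContinuousOn (refineLim s ω) P := by
  have hn : ∀ n : ℕ, ContinuousOn ((refine s)^[n] ω) P := by
    intro n
    induction n with
    | zero => exact hω
    | succ n ih =>
      rw [Function.iterate_succ_apply']
      exact continuousOn_finsetSum _ fun i _ => ih.comp (hs i) (h.subdiv.mem i)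
  refine TendstoLocallyUniformlyOn.continuousOn (F := fun n : ℕ => (refine s)^[n] ω) (p := atTop)
    ?_ (Frequently.of_forall hn)
  rw [Metric.tendstoLocallyUniformlyOn_iff]
  intro ε hε x hx
  have hev : ∀ᶠ y in 𝓝[P] x, ρ y < ρ x + 1 :=
    nhdsWithin_le_nhds (hρ.continuousAt.eventually_lt_const (by linarith))
  refine ⟨{y | ρ y < ρ x + 1} ∩ P, inter_mem hev self_mem_nhdsWithin, ?_⟩
  have h0 := sewConst_nonneg h.card_lt
  have lim : Tendsto (fun n : ℕ => c * (ρ x + 1) ^ γ * (Fintype.card ι / (2 : ℝ) ^ γ) ^ n *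
      sewConst (Fintype.card ι) γ) atTop
      (𝓝 (c * (ρ x + 1) ^ γ * 0 * sewConst (Fintype.card ι) γ)) :=
    ((tendsto_pow_atTop_nhds_zero_of_lt_one (by positivity) h.ratio_lt_one).const_mul _).mul_const _
  rw [mul_zero, zero_mul] at lim
  filter_upwards [lim.eventually_lt_const hε] with n hn y hy
  rw [dist_comm]
  refine ((h.dist_refineLim_le n hy.2).trans ?_).trans_lt hn
  have h1 := h.subdiv.size_nonneg y
  have h2 := h.exponent_nonneg
  have h3 := h.const_nonneg
  have h4 : ρ y ≤ ρ x + 1 := le_of_lt hy.1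
  gcongr

end IsAlmostAdditive

end Refinement

end

section

open Filter Topology AffineMap

/-! ### Sewing along segments. -/

section Segments

/-- Density of the rationals, written `k / (k + l)` because such a point leaves `k` equal parts on
one side and `l` on the other. -/
theorem eq_zero_of_rat {G : ℝ → ℝ} (hG : ContinuousOn G (Set.Icc 0 1))
    (h : ∀ k l : ℕ, 0 < k + l → G (k / (k + l : ℕ)) = 0) {t : ℝ} (ht : t ∈ Set.Icc (0 : ℝ) 1) :
    G t = 0 := by
  have lim : Tendsto (fun n : ℕ => (⌊t * n⌋₊ : ℝ) / n) atTop (𝓝 t) :=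
    (tendsto_nat_floor_mul_div_atTop ht.1).comp tendsto_natCast_atTop_atTop
  have hle : ∀ n : ℕ, ⌊t * n⌋₊ ≤ n := fun n => by
    refine Nat.floor_le_of_le ?_
    have := ht.2
    have hn : (0 : ℝ) ≤ n := n.cast_nonneg
    nlinarith
  have hmem : ∀ n : ℕ, (⌊t * n⌋₊ : ℝ) / n ∈ Set.Icc (0 : ℝ) 1 := fun n =>
    ⟨by positivity, div_le_one_of_le₀ (by exact_mod_cast hle n) n.cast_nonneg⟩
  have lim2 := (hG t ht).tendsto.comp
    (tendsto_nhdsWithin_iff.2 ⟨lim, Eventually.of_forall hmem⟩)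
  refine tendsto_nhds_unique lim2 ((tendsto_congr' ?_).2 tendsto_const_nhds)
  filter_upwards [eventually_gt_atTop 0] with n hn
  have e : ⌊t * n⌋₊ + (n - ⌊t * n⌋₊) = n := by have := hle n; omega
  have := h ⌊t * n⌋₊ (n - ⌊t * n⌋₊) (by omega)
  rwa [e] at this

/-- Telescoping over the fan of triangles with apex `x 0`: each term in the hypothesis is, up to
sign, the coboundary on one triangle of the fan. -/
theorem abs_sub_sum_range_le {V : Type*} (φ : V → V → ℝ) (x : ℕ → V) (e : ℝ) (h0 : φ (x 0) (x 0) = 0)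
    (n : ℕ) (h : ∀ i < n, |φ (x 0) (x (i + 1)) - φ (x 0) (x i) - φ (x i) (x (i + 1))| ≤ e) :
    |φ (x 0) (x n) - ∑ i ∈ Finset.range n, φ (x i) (x (i + 1))| ≤ n * e := by
  induction n with
  | zero => simp [h0]
  | succ n ih =>
    have h1 := ih fun i hi => h i (by omega)
    have h2 := h n (by omega)
    rw [Finset.sum_range_succ]
    push_cast
    rw [abs_le] at *
    constructor <;> linarith [h1.1, h1.2, h2.1, h2.2]

variable {V : Type*} [NormedAddCommGroup V] [NormedSpace ℝ V] {K : Set V}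

theorem lineMap_lineMap_left (p q : V) {k N : ℕ} (hk : k ≠ 0) (i : ℕ) :
    lineMap p (lineMap p q ((k : ℝ) / N) : V) ((i : ℝ) / k) = lineMap p q ((i : ℝ) / N) := by
  have hk' : (k : ℝ) ≠ 0 := by exact_mod_cast hk
  simp only [lineMap_apply_module', add_sub_cancel_right, smul_smul]
  congr 2
  field_simp

theorem lineMap_lineMap_right (p q : V) {k l : ℕ} (hl : l ≠ 0) (i : ℕ) :
    lineMap (lineMap p q ((k : ℝ) / (k + l : ℕ)) : V) q ((i : ℝ) / l) =
      lineMap p q (((k + i : ℕ) : ℝ) / (k + l : ℕ)) := by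
  have hl' : (l : ℝ) ≠ 0 := by exact_mod_cast hl
  have hkl : (k + l : ℝ) ≠ 0 := by positivity
  have e : ((k + i : ℕ) : ℝ) / (k + l : ℕ) = k / (k + l : ℕ) + i / l * (1 - k / (k + l : ℕ)) := by
    push_cast
    field_simp
    ring
  rw [e]
  simp only [lineMap_apply_module']
  module

theorem lineMap_div_mem (hK : Convex ℝ K) {p q : V} (hp : p ∈ K) (hq : q ∈ K) {i N : ℕ}
    (hi : i ≤ N) : (lineMap p q ((i : ℝ) / N) : V) ∈ K :=
  hK.lineMap_mem hp hq ⟨by positivity, div_le_one_of_le₀ (by exact_mod_cast hi) N.cast_nonneg⟩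

theorem dist_lineMap_div_le (p q : V) {i j N : ℕ} (hi : i ≤ N) (hj : j ≤ N) :
    dist (lineMap p q ((i : ℝ) / N) : V) (lineMap p q ((j : ℝ) / N)) ≤ dist p q := by
  rw [dist_lineMap_lineMap]
  refine mul_le_of_le_one_left dist_nonneg ?_
  refine (Real.dist_le_of_mem_Icc_01 ?_ ?_)
  all_goals exact ⟨by positivity, div_le_one_of_le₀ (by assumption_mod_cast) N.cast_nonneg⟩

/-- A continuous function of segments which is additive with respect to subdivisions in
segments of equal lengths is additive. -/
theorem add_eq_of_sum_eq (hK : Convex ℝ K) {φ : V → V → ℝ}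
    (hφ : ContinuousOn (Function.uncurry φ) (K ×ˢ K)) (h0 : ∀ x ∈ K, φ x x = 0)
    (hsum : ∀ x ∈ K, ∀ y ∈ K, ∀ N : ℕ, 0 < N → φ x y = ∑ i ∈ Finset.range N,
      φ (lineMap x y ((i : ℝ) / N)) (lineMap x y (((i + 1 : ℕ) : ℝ) / N)))
    {x y z : V} (hx : x ∈ K) (hy : y ∈ K) (hz : z ∈ segment ℝ x y) :
    φ x z + φ z y = φ x y := by
  rw [segment_eq_image_lineMap] at hz
  obtain ⟨t, ht, rfl⟩ := hz
  have hmaps : ∀ u ∈ Set.Icc (0 : ℝ) 1, (lineMap x y u : V) ∈ K := fun u hu =>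
    hK.lineMap_mem hx hy hu
  have hc : Continuous fun u : ℝ => (lineMap x y u : V) := lineMap_continuous
  have hG : ContinuousOn (fun u : ℝ => φ x (lineMap x y u) + φ (lineMap x y u) y - φ x y)
      (Set.Icc 0 1) := by
    refine ContinuousOn.sub (ContinuousOn.add ?_ ?_) continuousOn_const
    · exact hφ.comp (f := fun u : ℝ => (x, (lineMap x y u : V))) (by fun_prop)
        fun u hu => ⟨hx, hmaps u hu⟩
    · exact hφ.comp (f := fun u : ℝ => ((lineMap x y u : V), y)) (by fun_prop)
        fun u hu => ⟨hmaps u hu, hy⟩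
  have := eq_zero_of_rat hG (fun k l hkl => ?_) ht
  · simpa [sub_eq_zero] using this
  · rcases Nat.eq_zero_or_pos k with rfl | hk
    · simp [h0 x hx]
    rcases Nat.eq_zero_or_pos l with rfl | hl
    · have : (k : ℝ) ≠ 0 := by positivity
      simp [h0 y hy, this]
    have hzK : (lineMap x y ((k : ℝ) / (k + l : ℕ)) : V) ∈ K := lineMap_div_mem hK hx hy (by omega)
    -- The `k + l` equal parts of the whole segment are the `k` equal parts of the first piece
    -- followed by the `l` equal parts of the second.
    rw [hsum x hx y hy (k + l) hkl, hsum x hx _ hzK k hk, hsum _ hzK y hy l hl,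
      Finset.sum_range_add, sub_eq_zero]
    simp only [lineMap_lineMap_left x y hk.ne', lineMap_lineMap_right x y hl.ne', add_assoc]

/-- The halves of a segment. -/
noncomputable def segPiece : Fin 2 → V × V → V × V :=
  ![fun x => (x.1, midpoint ℝ x.1 x.2), fun x => (midpoint ℝ x.1 x.2, x.2)]

theorem refine_segPiece (G : V × V → ℝ) (x : V × V) :
    refine segPiece G x = G (x.1, midpoint ℝ x.1 x.2) + G (midpoint ℝ x.1 x.2, x.2) := by
  simp [refine, segPiece]

theorem isSubdivision_segPiece (hK : Convex ℝ K) :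
    IsSubdivision (segPiece (V := V)) (K ×ˢ K) (fun x => dist x.1 x.2) where
  mem i x hx := by
    have := hK.midpoint_mem hx.1 hx.2
    fin_cases i
    · exact ⟨hx.1, this⟩
    · exact ⟨this, hx.2⟩
  size_nonneg _ := dist_nonneg
  size_le i x _ := by
    fin_cases i
    · exact le_of_eq (by simp [segPiece]; ring)
    · exact le_of_eq (by simp [segPiece]; ring)

theorem continuous_segPiece (i : Fin 2) : Continuous (segPiece (V := V) i) := by
  fin_cases i
  all_goals
    simp only [segPiece, midpoint_eq_smul_add]
    simp
    split_ands <;> fun_prop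

theorem two_lt_rpow {β : ℝ} (hβ : 1 < β) : ((Fintype.card (Fin 2) : ℕ) : ℝ) < (2 : ℝ) ^ β := by
  simpa using Real.rpow_lt_rpow_of_exponent_lt (x := 2) (by norm_num) hβ

theorem eq_zero_of_midpoint_add (hK : Convex ℝ K) {β c : ℝ} (hβ : 1 < β) {G : V → V → ℝ}
    (hG : ∀ p ∈ K, ∀ q ∈ K, G p (midpoint ℝ p q) + G (midpoint ℝ p q) q = G p q)
    (hGc : ∀ p ∈ K, ∀ q ∈ K, |G p q| ≤ c * dist p q ^ β) {p q : V} (hp : p ∈ K) (hq : q ∈ K) :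
    G p q = 0 :=
  (isSubdivision_segPiece hK).eq_zero (G := Function.uncurry G) (by linarith) (two_lt_rpow hβ)
    (fun x hx => by rw [refine_segPiece]; exact hG _ hx.1 _ hx.2)
    (fun x hx => hGc _ hx.1 _ hx.2) (x := (p, q)) ⟨hp, hq⟩

theorem sum_range_two_mul (a : ℕ → ℝ) (N : ℕ) :
    ∑ i ∈ Finset.range (2 * N), a i =
      ∑ i ∈ Finset.range N, (a (2 * i) + a (2 * i + 1)) := by
  induction N with
  | zero => simp
  | succ N ih => rw [Nat.mul_succ, Finset.sum_range_succ, Finset.sum_range_succ, ih,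
      Finset.sum_range_succ, add_assoc]

/-- The exterior derivative of a function of two points. -/
def coboundary (ω : V → V → ℝ) (p q r : V) : ℝ := ω q r - ω p r + ω p q

/-- `ω` is closed up to an error of order `β > 1` on the convex set `K`. -/
structure IsAlmostClosed (K : Set V) (β B : ℝ) (ω : V → V → ℝ) : Prop where
  convex : Convex ℝ K
  one_lt : 1 < β
  const_nonneg : 0 ≤ B
  cont : ContinuousOn (Function.uncurry ω) (K ×ˢ K)
  le : ∀ p ∈ K, ∀ q ∈ K, ∀ r ∈ K, ∀ h, dist p q ≤ h → dist q r ≤ h → dist p r ≤ h →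
    |coboundary ω p q r| ≤ B * h ^ β

/-- The sewing of a function of segments. -/
noncomputable def sewSeg (ω : V → V → ℝ) (p q : V) : ℝ :=
  refineLim segPiece (Function.uncurry ω) (p, q)

namespace IsAlmostClosed

variable {β B : ℝ} {ω : V → V → ℝ} (h : IsAlmostClosed K β B ω)
include h

theorem isAlmostAdditive :
    IsAlmostAdditive segPiece (K ×ˢ K) (fun x => dist x.1 x.2) β B (Function.uncurry ω) where
  subdiv := isSubdivision_segPiece h.convex
  exponent_nonneg := by linarith [h.one_lt]
  card_lt := two_lt_rpow h.one_lt
  const_nonneg := h.const_nonneg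
  le x hx := by
    have hm := h.convex.midpoint_mem hx.1 hx.2
    have := h.le _ hx.1 _ hm _ hx.2 (dist x.1 x.2)
      (by simp; linarith [dist_nonneg (x := x.1) (y := x.2)])
      (by simp; linarith [dist_nonneg (x := x.1) (y := x.2)]) le_rfl
    rw [refine_segPiece, ← abs_neg]
    refine le_trans (le_of_eq ?_) this
    congr 1
    simp only [coboundary, Function.uncurry]
    ring

/-- The triangle `p, p, p` has size `0` and coboundary `ω p p`. -/
theorem self_eq_zero {p : V} (hp : p ∈ K) : ω p p = 0 := by
  have := h.le p hp p hp p hp 0 (by simp) (by simp) (by simp)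
  have hβ : β ≠ 0 := by linarith [h.one_lt]
  simpa [Real.zero_rpow hβ, coboundary] using this

theorem abs_sub_sewSeg_le {p q : V} (hp : p ∈ K) (hq : q ∈ K) :
    |ω p q - sewSeg ω p q| ≤ B * sewConst 2 β * dist p q ^ β := by
  refine (h.isAlmostAdditive.abs_sub_refineLim_le (x := (p, q)) ⟨hp, hq⟩).trans (le_of_eq ?_)
  simp
  ring

theorem sewSeg_midpoint_add {p q : V} (hp : p ∈ K) (hq : q ∈ K) :
    sewSeg ω p (midpoint ℝ p q) + sewSeg ω (midpoint ℝ p q) q = sewSeg ω p q := by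
  have := h.isAlmostAdditive.refine_refineLim (x := (p, q)) ⟨hp, hq⟩
  rwa [refine_segPiece] at this

theorem continuousOn_sewSeg : ContinuousOn (Function.uncurry (sewSeg ω)) (K ×ˢ K) :=
  h.isAlmostAdditive.continuousOn_refineLim (fun i => (continuous_segPiece i).continuousOn)
    (by fun_prop) h.cont

theorem sewConst_nonneg : 0 ≤ sewConst 2 β :=
  RoughForm.sewConst_nonneg (by simpa using two_lt_rpow h.one_lt)

/-- The symmetrization is additive at midpoints, and it is of order `β` because the coboundary on
`p, q, p` is `ω q p + ω p q`. -/
theorem sewSeg_swap {p q : V} (hp : p ∈ K) (hq : q ∈ K) : sewSeg ω q p = -sewSeg ω p q := by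
  have := eq_zero_of_midpoint_add h.convex h.one_lt (c := B + 2 * (B * sewConst 2 β))
    (G := fun p q => sewSeg ω p q + sewSeg ω q p) (fun p hp q hq => ?_) (fun p hp q hq => ?_) hp hq
  · linarith
  · have h1 := h.sewSeg_midpoint_add hp hq
    have h2 := h.sewSeg_midpoint_add hq hp
    rw [midpoint_comm] at h2
    linarith
  · have h1 := h.abs_sub_sewSeg_le hp hq
    have h2 := h.abs_sub_sewSeg_le hq hp
    have h3 := h.le p hp q hq p hp (dist p q) le_rfl (by rw [dist_comm]) (by simp)
    rw [coboundary, h.self_eq_zero hp] at h3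
    rw [dist_comm] at h2
    rw [abs_le] at *
    constructor <;> linarith [h1.1, h1.2, h2.1, h2.2, h3.1, h3.2]

theorem sewSeg_self {p : V} (hp : p ∈ K) : sewSeg ω p p = 0 := by
  have := h.sewSeg_swap hp hp
  linarith

theorem coboundary_sewSeg_le {p q r : V} (hp : p ∈ K) (hq : q ∈ K) (hr : r ∈ K) {ε : ℝ}
    (hpq : dist p q ≤ ε) (hqr : dist q r ≤ ε) (hpr : dist p r ≤ ε) :
    |coboundary (sewSeg ω) p q r| ≤ B * (1 + 3 * sewConst 2 β) * ε ^ β := by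
  have hβ : 0 ≤ β := by linarith [h.one_lt]
  have hc := mul_nonneg h.const_nonneg h.sewConst_nonneg
  have key : ∀ x ∈ K, ∀ y ∈ K, dist x y ≤ ε →
      |ω x y - sewSeg ω x y| ≤ B * sewConst 2 β * ε ^ β := fun x hx y hy hxy =>
    (h.abs_sub_sewSeg_le hx hy).trans (by gcongr)
  have h1 := key p hp q hq hpq
  have h2 := key q hq r hr hqr
  have h3 := key p hp r hr hpr
  have h4 := h.le p hp q hq r hr ε hpq hqr hpr
  rw [coboundary, abs_le] at *
  constructor <;> linarith [h1.1, h1.2, h2.1, h2.2, h3.1, h3.2, h4.1, h4.2]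

/-- The defect is of order `β` by the fan estimate; the factor `N` is harmless, `N` being fixed. It
is additive at midpoints because the `2 * N` equal parts can be grouped into `N` consecutive pairs,
or into the `N` parts of each half. -/
theorem sewSeg_eq_sum {p q : V} (hp : p ∈ K) (hq : q ∈ K) {N : ℕ} (hN : 0 < N) :
    sewSeg ω p q = ∑ i ∈ Finset.range N,
      sewSeg ω (lineMap p q ((i : ℝ) / N)) (lineMap p q (((i + 1 : ℕ) : ℝ) / N)) := by
  have hN' : (N : ℝ) ≠ 0 := by positivity
  have := eq_zero_of_midpoint_add h.convex h.one_lt (c := N * (B * (1 + 3 * sewConst 2 β)))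
    (G := fun p q => sewSeg ω p q - ∑ i ∈ Finset.range N,
      sewSeg ω (lineMap p q ((i : ℝ) / N)) (lineMap p q (((i + 1 : ℕ) : ℝ) / N)))
    (fun p hp q hq => ?_) (fun p hp q hq => ?_) hp hq
  · exact sub_eq_zero.1 this
  · have hm : midpoint ℝ p q = lineMap p q ((N : ℝ) / (N + N : ℕ)) := by
      rw [midpoint]
      congr 1
      push_cast
      field_simp
      norm_num
    have hsum : ∑ i ∈ Finset.range (2 * N), sewSeg ω (lineMap p q ((i : ℝ) / (N + N : ℕ)))
          (lineMap p q (((i + 1 : ℕ) : ℝ) / (N + N : ℕ))) = ∑ i ∈ Finset.range N,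
        sewSeg ω (lineMap p q ((i : ℝ) / N)) (lineMap p q (((i + 1 : ℕ) : ℝ) / N)) := by
      rw [sum_range_two_mul]
      refine Finset.sum_congr rfl fun i hi => ?_
      have hi := Finset.mem_range.1 hi
      have e : (lineMap p q (((2 * i + 1 : ℕ) : ℝ) / (N + N : ℕ)) : V) =
          midpoint ℝ (lineMap p q ((i : ℝ) / N) : V) (lineMap p q (((i + 1 : ℕ) : ℝ) / N)) := by
        have e' : ((2 * i + 1 : ℕ) : ℝ) / (N + N : ℕ) = 1 / 2 * (i / N + ((i + 1 : ℕ) : ℝ) / N) := by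
          push_cast
          field_simp
          ring
        rw [e']
        simp only [midpoint_eq_smul_add, lineMap_apply_module', invOf_eq_inv]
        module
      rw [e, show ((2 * i : ℕ) : ℝ) / (N + N : ℕ) = i / N by push_cast; field_simp; ring,
        show ((2 * i + 1 + 1 : ℕ) : ℝ) / (N + N : ℕ) = ((i + 1 : ℕ) : ℝ) / N by
          push_cast; field_simp; ring]
      exact h.sewSeg_midpoint_add (lineMap_div_mem h.convex hp hq (by omega))
        (lineMap_div_mem h.convex hp hq (by omega))
    have h1 := h.sewSeg_midpoint_add hp hq
    rw [← hsum, two_mul, Finset.sum_range_add]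
    simp only [hm, lineMap_lineMap_left p q hN.ne', lineMap_lineMap_right p q hN.ne'] at h1 ⊢
    simp only [add_assoc] at h1 ⊢
    linarith
  · have := abs_sub_sum_range_le (sewSeg ω) (fun i => lineMap p q ((i : ℝ) / N))
      (B * (1 + 3 * sewConst 2 β) * dist p q ^ β) (h.sewSeg_self (by simpa using hp)) N
      fun i hi => ?_
    · simpa [hN', mul_assoc] using this
    · have := h.coboundary_sewSeg_le (lineMap_div_mem h.convex hp hq (Nat.zero_le N))
        (lineMap_div_mem h.convex hp hq hi.le)
        (lineMap_div_mem h.convex hp hq (Nat.succ_le_of_lt hi))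
        (dist_lineMap_div_le p q (Nat.zero_le N) hi.le) (dist_lineMap_div_le p q hi.le hi)
        (dist_lineMap_div_le p q (Nat.zero_le N) hi)
      rw [← abs_neg] at this
      refine le_trans (le_of_eq ?_) this
      congr 1
      simp only [coboundary, Nat.succ_eq_add_one]
      ring

theorem sewSeg_add {p q z : V} (hp : p ∈ K) (hq : q ∈ K) (hz : z ∈ segment ℝ p q) :
    sewSeg ω p z + sewSeg ω z q = sewSeg ω p q :=
  add_eq_of_sum_eq h.convex h.continuousOn_sewSeg (fun _ hx => h.sewSeg_self hx)
    (fun _ hx _ hy _ hN => h.sewSeg_eq_sum hx hy hN) hp hq hz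

/-- One of the three points lies between the others; antisymmetry reduces each case to additivity on
the longest segment. -/
theorem coboundary_sewSeg_eq_zero {p q r : V} (hp : p ∈ K) (hq : q ∈ K) (hr : r ∈ K)
    (hc : Collinear ℝ {p, q, r}) : coboundary (sewSeg ω) p q r = 0 := by
  rw [coboundary]
  rcases hc.wbtw_or_wbtw_or_wbtw with hb | hb | hb
  · have := h.sewSeg_add hp hr (mem_segment_iff_wbtw.2 hb)
    linarith
  · have := h.sewSeg_add hq hp (mem_segment_iff_wbtw.2 hb)
    linarith [h.sewSeg_swap hp hq, h.sewSeg_swap hp hr]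
  · have := h.sewSeg_add hr hq (mem_segment_iff_wbtw.2 hb)
    linarith [h.sewSeg_swap hp hr, h.sewSeg_swap hq hr]

end IsAlmostClosed

end Segments

end

section

open Filter Topology AffineMap

/-! ### Subdivision of triangles and parallelograms by midlines. -/

section Triangles

variable {V : Type*} [NormedAddCommGroup V] [NormedSpace ℝ V] {K : Set V}

/-- The four pieces of a triangle, of half its size, which are cut out by its midlines. -/
noncomputable def triPiece : Fin 4 → V × V × V → V × V × V :=
  ![fun x => (x.1, midpoint ℝ x.1 x.2.1, midpoint ℝ x.1 x.2.2),
    fun x => (midpoint ℝ x.1 x.2.1, x.2.1, midpoint ℝ x.2.1 x.2.2),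
    fun x => (midpoint ℝ x.1 x.2.2, midpoint ℝ x.2.1 x.2.2, x.2.2),
    fun x => (midpoint ℝ x.2.1 x.2.2, midpoint ℝ x.1 x.2.2, midpoint ℝ x.1 x.2.1)]

/-- The diameter of a triangle. -/
noncomputable def triSize (x : V × V × V) : ℝ :=
  max (dist x.1 x.2.1) (max (dist x.2.1 x.2.2) (dist x.1 x.2.2))

/-- The sum of `G` over the four pieces of a triangle. -/
noncomputable def triSum (G : V → V → V → ℝ) (p q r : V) : ℝ :=
  G p (midpoint ℝ p q) (midpoint ℝ p r) + G (midpoint ℝ p q) q (midpoint ℝ q r) +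
    G (midpoint ℝ p r) (midpoint ℝ q r) r +
    G (midpoint ℝ q r) (midpoint ℝ p r) (midpoint ℝ p q)

theorem refine_triPiece (G : V → V → V → ℝ) (x : V × V × V) :
    refine triPiece (fun x => G x.1 x.2.1 x.2.2) x = triSum G x.1 x.2.1 x.2.2 := by
  simp [refine, triPiece, triSum, Fin.sum_univ_succ]
  ring

theorem dist_eq_half {x y u v : V} (h : x - y = (1 / 2 : ℝ) • (u - v)) :
    dist x y = dist u v / 2 := by
  rw [dist_eq_norm, h, norm_smul, dist_eq_norm]
  norm_num
  ring

theorem triSize_half {x y : V × V × V} {u : ℝ} (hu : |u| = 1 / 2)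
    (h1 : y.2.1 - y.1 = u • (x.2.1 - x.1)) (h2 : y.2.2 - y.1 = u • (x.2.2 - x.1)) :
    triSize y = triSize x / 2 := by
  have key : ∀ a b c d : V, a - b = u • (c - d) → dist a b = dist c d / 2 := by
    intro a b c d h
    rw [dist_eq_norm, h, norm_smul, dist_eq_norm, Real.norm_eq_abs, hu]
    ring
  have h3 : y.2.1 - y.2.2 = u • (x.2.1 - x.2.2) := by
    rw [← sub_sub_sub_cancel_right _ _ y.1, h1, h2]
    module
  rw [triSize, triSize, dist_comm y.1, dist_comm y.1, key _ _ _ _ h1, key _ _ _ _ h2,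
    key _ _ _ _ h3, dist_comm x.1, dist_comm x.1, max_div_div_right (by norm_num),
    max_div_div_right (by norm_num)]

/-- The pieces of a triangle are homothetic to it, with ratio `± 1 / 2`. -/
theorem triPiece_homothetic (i : Fin 4) (x : V × V × V) : ∃ u : ℝ, |u| = 1 / 2 ∧
    (triPiece i x).2.1 - (triPiece i x).1 = u • (x.2.1 - x.1) ∧
    (triPiece i x).2.2 - (triPiece i x).1 = u • (x.2.2 - x.1) := by
  fin_cases i
  · refine ⟨1 / 2, by norm_num, ?_, ?_⟩ <;>
    · simp only [triPiece, midpoint_eq_smul_add, invOf_eq_inv]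
      simp
      module
  · refine ⟨1 / 2, by norm_num, ?_, ?_⟩ <;>
    · simp only [triPiece, midpoint_eq_smul_add, invOf_eq_inv]
      simp
      module
  · refine ⟨1 / 2, by norm_num, ?_, ?_⟩ <;>
    · simp only [triPiece, midpoint_eq_smul_add, invOf_eq_inv]
      simp
      module
  -- The central piece, with each vertex replaced by the midpoint of the opposite side, is a point
  -- reflection of the triangle, scaled by one half.
  · refine ⟨-(1 / 2), by norm_num, ?_, ?_⟩ <;>
    · simp only [triPiece, midpoint_eq_smul_add, invOf_eq_inv]
      simp
      module

theorem triPiece_mem (hK : Convex ℝ K) (i : Fin 4) {x : V × V × V} (hx : x ∈ K ×ˢ K ×ˢ K) :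
    triPiece i x ∈ K ×ˢ K ×ˢ K := by
  have h1 := hK.midpoint_mem hx.1 hx.2.1
  have h2 := hK.midpoint_mem hx.1 hx.2.2
  have h3 := hK.midpoint_mem hx.2.1 hx.2.2
  fin_cases i
  · exact ⟨hx.1, h1, h2⟩
  · exact ⟨h1, hx.2.1, h3⟩
  · exact ⟨h2, h3, hx.2.2⟩
  · exact ⟨h3, h2, h1⟩

theorem isSubdivision_triPiece (hK : Convex ℝ K) :
    IsSubdivision (triPiece (V := V)) (K ×ˢ K ×ˢ K) triSize where
  mem i _ hx := triPiece_mem hK i hx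
  size_nonneg _ := le_max_of_le_left dist_nonneg
  size_le i x _ := by
    obtain ⟨u, hu, h1, h2⟩ := triPiece_homothetic i x
    exact (triSize_half hu h1 h2).le

theorem continuous_triPiece (i : Fin 4) : Continuous (triPiece (V := V) i) := by
  fin_cases i
  all_goals
    simp only [triPiece, midpoint_eq_smul_add]
    simp
    split_ands <;> fun_prop

theorem four_lt_rpow {γ : ℝ} (hγ : 2 < γ) : ((Fintype.card (Fin 4) : ℕ) : ℝ) < (2 : ℝ) ^ γ := by
  have := Real.rpow_lt_rpow_of_exponent_lt (x := 2) (by norm_num) hγ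
  norm_num at this ⊢
  exact this

theorem eq_zero_of_triSum_eq (hK : Convex ℝ K) {γ c : ℝ} (hγ : 2 < γ) {G : V → V → V → ℝ}
    (hG : ∀ p ∈ K, ∀ q ∈ K, ∀ r ∈ K, triSum G p q r = G p q r)
    (hGc : ∀ p ∈ K, ∀ q ∈ K, ∀ r ∈ K, ∀ h, dist p q ≤ h → dist q r ≤ h → dist p r ≤ h →
      |G p q r| ≤ c * h ^ γ) {p q r : V} (hp : p ∈ K) (hq : q ∈ K) (hr : r ∈ K) :
    G p q r = 0 :=
  (isSubdivision_triPiece hK).eq_zero (G := fun x => G x.1 x.2.1 x.2.2) (by linarith)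
    (four_lt_rpow hγ) (fun x hx => by rw [refine_triPiece]; exact hG _ hx.1 _ hx.2.1 _ hx.2.2)
    (fun x hx => hGc _ hx.1 _ hx.2.1 _ hx.2.2 _ (le_max_left _ _)
      ((le_max_left _ _).trans (le_max_right _ _)) ((le_max_right _ _).trans (le_max_right _ _)))
    (x := (p, q, r)) ⟨hp, hq, hr⟩

/-- The four pieces of the parallelogram with vertices `a, b, b + d - a, d`. -/
noncomputable def parPiece : Fin 4 → V × V × V → V × V × V :=
  ![fun x => (x.1, midpoint ℝ x.1 x.2.1, midpoint ℝ x.1 x.2.2),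
    fun x => (midpoint ℝ x.1 x.2.1, x.2.1, midpoint ℝ x.2.1 x.2.2),
    fun x => (midpoint ℝ x.1 x.2.2, midpoint ℝ x.2.1 x.2.2, x.2.2),
    fun x => (midpoint ℝ x.2.1 x.2.2, midpoint ℝ x.2.1 (x.2.1 + x.2.2 - x.1),
      midpoint ℝ (x.2.1 + x.2.2 - x.1) x.2.2)]

/-- The sum of two adjacent sides is exactly halved and dominates the sides and both diagonals, so
it serves as the size. -/
theorem isSubdivision_parPiece (hK : Convex ℝ K) :
    IsSubdivision (parPiece (V := V))
      {x | x.1 ∈ K ∧ x.2.1 ∈ K ∧ x.2.2 ∈ K ∧ x.2.1 + x.2.2 - x.1 ∈ K}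
      (fun x => dist x.1 x.2.1 + dist x.1 x.2.2) where
  mem i x hx := by
    obtain ⟨a, b, d⟩ := x
    obtain ⟨ha, hb, hd, hc⟩ := hx
    dsimp only at ha hb hd hc
    have h1 := hK.midpoint_mem ha hb
    have h2 := hK.midpoint_mem ha hd
    have h3 := hK.midpoint_mem hb hd
    have h4 := hK.midpoint_mem hb hc
    have h5 := hK.midpoint_mem hc hd
    fin_cases i
    · refine ⟨ha, h1, h2, ?_⟩
      convert h3 using 1
      simp only [parPiece, midpoint_eq_smul_add, invOf_eq_inv]
      simp
      module
    · refine ⟨h1, hb, h3, ?_⟩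
      convert h4 using 1
      simp only [parPiece, midpoint_eq_smul_add, invOf_eq_inv]
      simp
      module
    · refine ⟨h2, h3, hd, ?_⟩
      convert h5 using 1
      simp only [parPiece, midpoint_eq_smul_add, invOf_eq_inv]
      simp
      module
    · refine ⟨h3, h4, h5, ?_⟩
      convert hc using 1
      simp only [parPiece, midpoint_eq_smul_add, invOf_eq_inv]
      simp
      module
  size_nonneg _ := by positivity
  size_le i x _ := by
    obtain ⟨a, b, d⟩ := x
    have key : ∀ y : V × V × V, y.1 - y.2.1 = (1 / 2 : ℝ) • (a - b) →
        y.1 - y.2.2 = (1 / 2 : ℝ) • (a - d) →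
        dist y.1 y.2.1 + dist y.1 y.2.2 ≤ (dist a b + dist a d) / 2 := by
      intro y h1 h2
      rw [dist_eq_half h1, dist_eq_half h2]
      linarith
    refine key _ ?_ ?_
    all_goals
      fin_cases i
      all_goals
        simp only [parPiece, midpoint_eq_smul_add, invOf_eq_inv]
        simp
        module

/-- Closed functions on a grid have a potential. -/
theorem exists_grid_potential {m n : ℕ} {A B : ℕ → ℕ → ℝ}
    (h : ∀ i < m, ∀ j < n, A i j + B (i + 1) j = B i j + A i (j + 1)) :
    ∃ U : ℕ → ℕ → ℝ, (∀ i < m, ∀ j ≤ n, A i j = U (i + 1) j - U i j) ∧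
      ∀ i j, B i j = U i (j + 1) - U i j := by
  -- Sum along the bottom row, then up the column.
  refine ⟨fun i j => ∑ k ∈ Finset.range i, A k 0 + ∑ l ∈ Finset.range j, B i l, ?_, ?_⟩
  · intro i hi j hj
    induction j with
    | zero => simp [Finset.sum_range_succ]
    | succ j ih =>
      have h1 := ih (by omega)
      have h2 := h i hi j (by omega)
      simp only [Finset.sum_range_succ] at h1 ⊢
      linarith
  · intro i j
    simp [Finset.sum_range_succ]

end Triangles

end

section

open Filter Topology AffineMap

/-! ### Sewing `f ∪ δη` along triangles. -/

section Area

variable {V : Type*} [NormedAddCommGroup V] [NormedSpace ℝ V] {K : Set V}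

/-- A function `f` of Hölder class `α` on the convex set `K`, and a function `η` of segments,
additive on each line, whose coboundary is of order `β`, with `α + β > 2`. -/
structure IsAreaPair (K : Set V) (α β A B : ℝ) (f : V → ℝ) (η : V → V → ℝ) : Prop where
  convex : Convex ℝ K
  pos : 0 < α
  nonneg : 0 ≤ β
  two_lt : 2 < α + β
  holderConst_nonneg : 0 ≤ A
  const_nonneg : 0 ≤ B
  cont : ContinuousOn f K
  holder : ∀ p ∈ K, ∀ q ∈ K, |f p - f q| ≤ A * dist p q ^ α
  cont_seg : ContinuousOn (Function.uncurry η) (K ×ˢ K)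
  midpoint_add : ∀ p ∈ K, ∀ q ∈ K, η p (midpoint ℝ p q) + η (midpoint ℝ p q) q = η p q
  swap : ∀ p ∈ K, ∀ q ∈ K, η q p = -η p q
  eq_zero : ∀ p ∈ K, ∀ q ∈ K, ∀ r ∈ K, Collinear ℝ {p, q, r} → coboundary η p q r = 0
  le : ∀ p ∈ K, ∀ q ∈ K, ∀ r ∈ K, ∀ h, dist p q ≤ h → dist q r ≤ h → dist p r ≤ h →
    |coboundary η p q r| ≤ B * h ^ β

/-- The sewing of the function `f(p) (δη)(p, q, r)` of triangles. -/
noncomputable def sewTri (f : V → ℝ) (η : V → V → ℝ) (p q r : V) : ℝ :=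
  refineLim triPiece (fun x => f x.1 * coboundary η x.1 x.2.1 x.2.2) (p, q, r)

theorem dist_midpoints_le {p q r : V} {h : ℝ} (hqr : dist q r ≤ h) :
    dist (midpoint ℝ p q) (midpoint ℝ p r) ≤ h / 2 := by
  rw [dist_eq_half (u := q) (v := r)]
  · linarith
  · simp only [midpoint_eq_smul_add, invOf_eq_inv]
    module

theorem dist_le_of_mem_segment {p x y z : V} {h : ℝ} (hx : dist p x ≤ h) (hy : dist p y ≤ h)
    (hz : z ∈ segment ℝ x y) : dist p z ≤ h := by
  have := (convex_closedBall p h).segment_subset (Metric.mem_closedBall'.2 hx)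
    (Metric.mem_closedBall'.2 hy) hz
  exact Metric.mem_closedBall'.1 this

theorem lineMap_div_mem_segment (p q : V) {i N : ℕ} (hi : i ≤ N) :
    (lineMap p q ((i : ℝ) / N) : V) ∈ segment ℝ p q :=
  lineMap_div_mem (convex_segment p q) (left_mem_segment ℝ p q) (right_mem_segment ℝ p q) hi

namespace IsAreaPair

variable {α β A B : ℝ} {f : V → ℝ} {η : V → V → ℝ} (h : IsAreaPair K α β A B f η)
include h

theorem abs_mul_le {x y p q r : V} (hx : x ∈ K) (hy : y ∈ K) (hp : p ∈ K) (hq : q ∈ K)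
    (hr : r ∈ K) {ε : ℝ} (hxy : dist x y ≤ ε) (hpq : dist p q ≤ ε) (hqr : dist q r ≤ ε)
    (hpr : dist p r ≤ ε) : |(f x - f y) * coboundary η p q r| ≤ A * B * ε ^ (α + β) := by
  have hε : 0 ≤ ε := dist_nonneg.trans hxy
  have hα := h.pos
  have h1 : |f x - f y| ≤ A * ε ^ α :=
    (h.holder x hx y hy).trans (by have := h.holderConst_nonneg; gcongr)
  have h2 := h.le p hp q hq r hr ε hpq hqr hpr
  have hA : 0 ≤ A * ε ^ α := mul_nonneg h.holderConst_nonneg (by positivity)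
  rw [abs_mul, Real.rpow_add_of_nonneg hε h.pos.le h.nonneg]
  calc |f x - f y| * |coboundary η p q r| ≤ (A * ε ^ α) * (B * ε ^ β) := by gcongr
    _ = _ := by ring

theorem coboundary_rotate {p q r : V} (hp : p ∈ K) (hq : q ∈ K) (hr : r ∈ K) :
    coboundary η q r p = coboundary η p q r := by
  simp only [coboundary]
  linarith [h.swap p hp q hq, h.swap p hp r hr]

theorem coboundary_swap {p q r : V} (hq : q ∈ K) (hr : r ∈ K) :
    coboundary η p r q = -coboundary η p q r := by
  simp only [coboundary]
  linarith [h.swap q hq r hr]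

/-- The inner edges cancel by antisymmetry, and each outer edge is the sum of its halves. -/
theorem triSum_coboundary {p q r : V} (hp : p ∈ K) (hq : q ∈ K) (hr : r ∈ K) :
    triSum (coboundary η) p q r = coboundary η p q r := by
  have h1 := h.midpoint_add p hp q hq
  have h2 := h.midpoint_add q hq r hr
  have h3 := h.midpoint_add p hp r hr
  have ha := h.convex.midpoint_mem hp hq
  have hm := h.convex.midpoint_mem hq hr
  have hc := h.convex.midpoint_mem hp hr
  simp only [triSum, coboundary]
  linarith [h.swap _ ha _ hm, h.swap _ ha _ hc, h.swap _ hm _ hc]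

/-- By exact additivity of `coboundary η`, each piece contributes only the change of `f` between `p`
and its own first vertex. The corner piece at `p` contributes nothing; the other three give the
factor `3`. -/
theorem isAlmostAdditive : IsAlmostAdditive triPiece (K ×ˢ K ×ˢ K) triSize (α + β) (3 * (A * B))
    (fun x => f x.1 * coboundary η x.1 x.2.1 x.2.2) where
  subdiv := isSubdivision_triPiece h.convex
  exponent_nonneg := by linarith [h.two_lt]
  card_lt := four_lt_rpow h.two_lt
  const_nonneg := by
    have := h.holderConst_nonneg
    have := h.const_nonneg
    positivity
  le x hx := by
    obtain ⟨p, q, r⟩ := x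
    obtain ⟨hp, hq, hr⟩ := hx
    dsimp only at hp hq hr
    have ha := h.convex.midpoint_mem hp hq
    have hm := h.convex.midpoint_mem hq hr
    have hc := h.convex.midpoint_mem hp hr
    set ε := triSize (p, q, r) with hε
    have hpq : dist p q ≤ ε := le_max_left _ _
    have hqr : dist q r ≤ ε := (le_max_left _ _).trans (le_max_right _ _)
    have hpr : dist p r ≤ ε := (le_max_right _ _).trans (le_max_right _ _)
    have hε0 : 0 ≤ ε := dist_nonneg.trans hpq
    have half : ∀ {x y z : V}, dist y z ≤ ε → dist (midpoint ℝ x y) (midpoint ℝ x z) ≤ ε :=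
      fun h' => (dist_midpoints_le h').trans (by linarith)
    have hmid : ∀ {x y : V}, dist x y ≤ ε → dist x (midpoint ℝ x y) ≤ ε := fun h' => by
      rw [dist_left_midpoint]
      norm_num
      linarith
    have hmid' : ∀ {x y : V}, dist x y ≤ ε → dist (midpoint ℝ x y) y ≤ ε := fun h' => by
      rw [dist_midpoint_right]
      norm_num
      linarith
    have e1 : dist (midpoint ℝ p q) (midpoint ℝ q r) ≤ ε := by
      rw [midpoint_comm p q]
      exact half hpr
    have e2 : dist (midpoint ℝ p r) (midpoint ℝ q r) ≤ ε := by
      rw [midpoint_comm p r, midpoint_comm q r]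
      exact half hpq
    have b1 := h.abs_mul_le hp ha ha hq hm (hmid hpq) (hmid' hpq) (hmid hqr) e1
    have b2 := h.abs_mul_le hp hc hc hm hr (hmid hpr) e2 (hmid' hqr) (hmid' hpr)
    have b3 := h.abs_mul_le hp hm hm hc ha (dist_le_of_mem_segment hpq hpr
      (midpoint_mem_segment q r)) (by rwa [dist_comm]) (by rw [dist_comm]; exact half hqr)
      (by rwa [dist_comm])
    have hsum := h.triSum_coboundary hp hq hr
    rw [refine_triPiece (fun p q r => f p * coboundary η p q r)]
    simp only [triSum] at hsum ⊢
    rw [← hsum]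
    rw [abs_le] at *
    constructor <;> linarith [b1.1, b1.2, b2.1, b2.2, b3.1, b3.2]

theorem abs_sub_sewTri_le {p q r : V} (hp : p ∈ K) (hq : q ∈ K) (hr : r ∈ K) {ε : ℝ}
    (hpq : dist p q ≤ ε) (hqr : dist q r ≤ ε) (hpr : dist p r ≤ ε) :
    |f p * coboundary η p q r - sewTri f η p q r| ≤
      3 * (A * B) * sewConst 4 (α + β) * ε ^ (α + β) := by
  have hA := h.holderConst_nonneg
  have hB := h.const_nonneg
  have hγ : 0 ≤ α + β := by linarith [h.two_lt]
  have hs : 0 ≤ sewConst 4 (α + β) := sewConst_nonneg (by simpa using four_lt_rpow h.two_lt)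
  have h0 : 0 ≤ triSize (p, q, r) := (isSubdivision_triPiece h.convex).size_nonneg _
  have hle : triSize (p, q, r) ≤ ε := max_le hpq (max_le hqr hpr)
  refine (h.isAlmostAdditive.abs_sub_refineLim_le (x := (p, q, r)) ⟨hp, hq, hr⟩).trans ?_
  rw [Fintype.card_fin, mul_right_comm]
  gcongr

theorem triSum_sewTri {p q r : V} (hp : p ∈ K) (hq : q ∈ K) (hr : r ∈ K) :
    triSum (sewTri f η) p q r = sewTri f η p q r := by
  have := h.isAlmostAdditive.refine_refineLim (x := (p, q, r)) ⟨hp, hq, hr⟩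
  rw [← refine_triPiece (sewTri f η) (p, q, r)]
  exact this

theorem continuousOn_sewTri :
    ContinuousOn (fun x : V × V × V => sewTri f η x.1 x.2.1 x.2.2) (K ×ˢ K ×ˢ K) := by
  refine h.isAlmostAdditive.continuousOn_refineLim
    (fun i => (continuous_triPiece i).continuousOn) (by unfold triSize; fun_prop) ?_
  have h1 : ContinuousOn (fun x : V × V × V => f x.1) (K ×ˢ K ×ˢ K) :=
    h.cont.comp (by fun_prop) fun x hx => hx.1
  have h2 : ContinuousOn (fun x : V × V × V => η x.1 x.2.1) (K ×ˢ K ×ˢ K) :=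
    h.cont_seg.comp (f := fun x : V × V × V => (x.1, x.2.1)) (by fun_prop)
      fun x hx => ⟨hx.1, hx.2.1⟩
  have h3 : ContinuousOn (fun x : V × V × V => η x.1 x.2.2) (K ×ˢ K ×ˢ K) :=
    h.cont_seg.comp (f := fun x : V × V × V => (x.1, x.2.2)) (by fun_prop)
      fun x hx => ⟨hx.1, hx.2.2⟩
  have h4 : ContinuousOn (fun x : V × V × V => η x.2.1 x.2.2) (K ×ˢ K ×ˢ K) :=
    h.cont_seg.comp (f := fun x : V × V × V => (x.2.1, x.2.2)) (by fun_prop)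
      fun x hx => ⟨hx.2.1, hx.2.2⟩
  exact h1.mul ((h4.sub h3).add h2)

/-- The constant in the estimate of the coboundary of `sewTri f η`. -/
noncomputable def _root_.RoughForm.coboundaryConst (α β A B : ℝ) : ℝ :=
  A * B + 4 * (3 * (A * B) * sewConst 4 (α + β))

/-- Before sewing, the coboundary is exactly `(f q - f p) * coboundary η q r s`, of order `α + β`;
replacing the four faces by their sewn values costs four sewing errors. -/
theorem coboundary_sewTri_le {p q r s : V} (hp : p ∈ K) (hq : q ∈ K) (hr : r ∈ K) (hs : s ∈ K)
    {ε : ℝ} (hpq : dist p q ≤ ε) (hpr : dist p r ≤ ε) (hps : dist p s ≤ ε) (hqr : dist q r ≤ ε)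
    (hqs : dist q s ≤ ε) (hrs : dist r s ≤ ε) :
    |sewTri f η q r s - sewTri f η p r s + sewTri f η p q s - sewTri f η p q r| ≤
      coboundaryConst α β A B * ε ^ (α + β) := by
  have h0 := h.abs_mul_le hq hp hq hr hs (by rwa [dist_comm]) hqr hrs hqs
  have h1 := h.abs_sub_sewTri_le hq hr hs hqr hrs hqs
  have h2 := h.abs_sub_sewTri_le hp hr hs hpr hrs hps
  have h3 := h.abs_sub_sewTri_le hp hq hs hpq hqs hps
  have h4 := h.abs_sub_sewTri_le hp hq hr hpq hqr hpr
  have h5 : (f q - f p) * coboundary η q r s = f q * coboundary η q r s -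
      f p * coboundary η p r s + f p * coboundary η p q s - f p * coboundary η p q r := by
    simp only [coboundary]
    ring
  rw [h5] at h0
  rw [coboundaryConst, abs_le] at *
  constructor <;>
    linarith [h0.1, h0.2, h1.1, h1.2, h2.1, h2.2, h3.1, h3.2, h4.1, h4.2]

/-- Rotation preserves `coboundary η` and permutes the midline pieces; it moves only the point where
`f` is evaluated, at a cost of order `α + β`. -/
theorem sewTri_rotate {p q r : V} (hp : p ∈ K) (hq : q ∈ K) (hr : r ∈ K) :
    sewTri f η q r p = sewTri f η p q r := by
  have := eq_zero_of_triSum_eq h.convex h.two_lt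
    (c := A * B + 2 * (3 * (A * B) * sewConst 4 (α + β)))
    (G := fun p q r => sewTri f η q r p - sewTri f η p q r)
    (fun p hp q hq r hr => ?_) (fun p hp q hq r hr ε hpq hqr hpr => ?_) hp hq hr
  · linarith
  · rw [← h.triSum_sewTri hp hq hr, ← h.triSum_sewTri hq hr hp]
    simp only [triSum, midpoint_comm q p, midpoint_comm r p]
    ring
  · have hqp : dist q p ≤ ε := by rwa [dist_comm]
    have hrp : dist r p ≤ ε := by rwa [dist_comm]
    have h0 := h.abs_mul_le hq hp hp hq hr hqp hpq hqr hpr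
    have h1 := h.abs_sub_sewTri_le hp hq hr hpq hqr hpr
    have h2 := h.abs_sub_sewTri_le hq hr hp hqr hrp hqp
    rw [h.coboundary_rotate hp hq hr] at h2
    rw [abs_le] at *
    constructor <;> linarith [h0.1, h0.2, h1.1, h1.2, h2.1, h2.2]

theorem sewTri_swap {p q r : V} (hp : p ∈ K) (hq : q ∈ K) (hr : r ∈ K) :
    sewTri f η p r q = -sewTri f η p q r := by
  have := eq_zero_of_triSum_eq h.convex h.two_lt
    (c := 2 * (3 * (A * B) * sewConst 4 (α + β)))
    (G := fun p q r => sewTri f η p r q + sewTri f η p q r)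
    (fun p hp q hq r hr => ?_) (fun p hp q hq r hr ε hpq hqr hpr => ?_) hp hq hr
  · linarith
  · rw [← h.triSum_sewTri hp hq hr, ← h.triSum_sewTri hp hr hq]
    simp only [triSum, midpoint_comm r q]
    ring
  · have h1 := h.abs_sub_sewTri_le hp hq hr hpq hqr hpr
    have h2 := h.abs_sub_sewTri_le hp hr hq hpr (by rwa [dist_comm]) hpq
    rw [h.coboundary_swap hq hr] at h2
    rw [abs_le] at *
    constructor <;> linarith [h1.1, h1.2, h2.1, h2.2]

/-- On the intersection of `K` with a line the function being sewn is `0`, so `sewTri f η` is itself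
of order `α + β` and invariant there. -/
theorem sewTri_collinear {p q r : V} (hp : p ∈ K) (hq : q ∈ K) (hr : r ∈ K)
    (hc : Collinear ℝ {p, q, r}) : sewTri f η p q r = 0 := by
  obtain ⟨o, v, hv⟩ := (collinear_iff_exists_forall_eq_smul_vadd (k := ℝ) _).1 hc
  set L : Set V := K ∩ {x | ∃ t : ℝ, x = t • v +ᵥ o}
  have hL : Convex ℝ L := by
    refine h.convex.inter ?_
    rintro _ ⟨s, rfl⟩ _ ⟨t, rfl⟩ a b _ _ hab
    refine ⟨a * s + b * t, ?_⟩
    have hb : b = 1 - a := by linarith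
    simp only [vadd_eq_add, hb]
    module
  refine eq_zero_of_triSum_eq hL h.two_lt (c := 3 * (A * B) * sewConst 4 (α + β))
    (fun p hp q hq r hr => h.triSum_sewTri hp.1 hq.1 hr.1)
    (fun p hp q hq r hr ε hpq hqr hpr => ?_) ⟨hp, hv p (by simp)⟩ ⟨hq, hv q (by simp)⟩
    ⟨hr, hv r (by simp)⟩
  have h1 := h.abs_sub_sewTri_le hp.1 hq.1 hr.1 hpq hqr hpr
  have hc' : Collinear ℝ {p, q, r} := by
    refine (collinear_iff_exists_forall_eq_smul_vadd (k := ℝ) _).2 ⟨o, v, ?_⟩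
    rintro x (rfl | rfl | rfl)
    exacts [hp.2, hq.2, hr.2]
  rwa [h.eq_zero p hp.1 q hq.1 r hr.1 hc', mul_zero, zero_sub, abs_neg] at h1

/-- The difference of the two triangulations is, up to sign, a coboundary, hence of order `α + β`.
Cutting all four triangles by midlines and regrouping, up to rotations, gives the same difference on
the four quarters of the parallelogram, so it vanishes. -/
theorem sewTri_flip {a b c d : V} (ha : a ∈ K) (hb : b ∈ K) (hc : c ∈ K) (hd : d ∈ K)
    (habcd : a + c = b + d) :
    sewTri f η a b c + sewTri f η a c d = sewTri f η a b d + sewTri f η b c d := by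
  obtain rfl : c = b + d - a := by rw [← habcd]; simp
  have := (isSubdivision_parPiece h.convex).eq_zero (γ := α + β) (c := coboundaryConst α β A B)
    (G := fun x => sewTri f η x.1 x.2.1 (x.2.1 + x.2.2 - x.1) +
      sewTri f η x.1 (x.2.1 + x.2.2 - x.1) x.2.2 - sewTri f η x.1 x.2.1 x.2.2 -
      sewTri f η x.2.1 (x.2.1 + x.2.2 - x.1) x.2.2)
    (by linarith [h.two_lt]) (four_lt_rpow h.two_lt) (fun x hx => ?_) (fun x hx => ?_)
    (x := (a, b, d)) ⟨ha, hb, hd, hc⟩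
  · dsimp only at this
    linarith
  · obtain ⟨a, b, d⟩ := x
    obtain ⟨ha, hb, hd, hc⟩ := hx
    dsimp only at ha hb hd hc
    have h1 := h.convex.midpoint_mem ha hb
    have h2 := h.convex.midpoint_mem ha hd
    have h3 := h.convex.midpoint_mem hb hd
    have h4 := h.convex.midpoint_mem hb hc
    have h5 := h.convex.midpoint_mem hc hd
    have e0 : midpoint ℝ a (b + d - a) = midpoint ℝ b d := by
      simp only [midpoint_eq_smul_add]
      congr 1
      abel
    have e1 : midpoint ℝ a b + midpoint ℝ a d - a = midpoint ℝ b d := by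
      simp only [midpoint_eq_smul_add, invOf_eq_inv]
      module
    have e2 : b + midpoint ℝ b d - midpoint ℝ a b = midpoint ℝ b (b + d - a) := by
      simp only [midpoint_eq_smul_add, invOf_eq_inv]
      module
    have e3 : midpoint ℝ b d + d - midpoint ℝ a d = midpoint ℝ (b + d - a) d := by
      simp only [midpoint_eq_smul_add, invOf_eq_inv]
      module
    have e4 : midpoint ℝ b (b + d - a) + midpoint ℝ (b + d - a) d - midpoint ℝ b d =
        b + d - a := by
      simp only [midpoint_eq_smul_add, invOf_eq_inv]
      module
    simp only [refine, parPiece, Fin.sum_univ_four, Matrix.cons_val, e1, e2, e3, e4]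
    rw [← h.triSum_sewTri ha hb hc, ← h.triSum_sewTri ha hc hd, ← h.triSum_sewTri ha hb hd,
      ← h.triSum_sewTri hb hc hd]
    simp only [triSum, e0]
    rw [h.sewTri_rotate h1 h4 h3, ← h.sewTri_rotate h5 h2 h3, h.sewTri_rotate h1 h3 h2,
      ← h.sewTri_rotate h5 h3 h4]
    ring
  · obtain ⟨a, b, d⟩ := x
    obtain ⟨ha, hb, hd, hc⟩ := hx
    dsimp only at ha hb hd hc ⊢
    have e1 : dist a (b + d - a) ≤ dist a b + dist a d := by
      rw [dist_eq_norm, dist_eq_norm, dist_eq_norm]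
      refine le_trans (le_of_eq ?_) (norm_add_le _ _)
      congr 1
      abel
    have e2 : dist b (b + d - a) = dist a d := by
      rw [dist_eq_norm, dist_eq_norm]
      congr 1
      abel
    have e3 : dist (b + d - a) d = dist a b := by
      rw [dist_comm, dist_eq_norm, dist_eq_norm]
      congr 1
      abel
    have hab := dist_nonneg (x := a) (y := b)
    have had := dist_nonneg (x := a) (y := d)
    have := h.coboundary_sewTri_le ha hb hc hd (ε := dist a b + dist a d) (by linarith) e1
      (by linarith) (by linarith) ((dist_triangle_left b d a)) (by linarith)
    rw [← abs_neg]
    refine le_trans (le_of_eq ?_) this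
    congr 1
    ring

end IsAreaPair

end Area

end

section

open Filter Topology AffineMap

/-! ### Arbitrary cuts and closedness on planes. -/

section Closed

variable {V : Type*} [NormedAddCommGroup V] [NormedSpace ℝ V] {K : Set V}

theorem lineMap_two_mul_div (q r : V) (j N : ℕ) :
    (lineMap q r (((2 * j : ℕ) : ℝ) / (N + N : ℕ)) : V) = lineMap q r ((j : ℝ) / N) := by
  congr 1
  rcases Nat.eq_zero_or_pos N with rfl | hN
  · simp
  · push_cast
    field_simp
    ring

theorem midpoint_lineMap_div (q r : V) (i j N : ℕ) :
    midpoint ℝ (lineMap q r ((i : ℝ) / N) : V) (lineMap q r ((j : ℝ) / N)) =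
      lineMap q r (((i + j : ℕ) : ℝ) / (N + N : ℕ)) := by
  have e : ((i + j : ℕ) : ℝ) / (N + N : ℕ) = 1 / 2 * (i / N + (j : ℝ) / N) := by
    rcases Nat.eq_zero_or_pos N with rfl | hN
    · simp
    · push_cast
      field_simp
      norm_num
  rw [e]
  simp only [midpoint_eq_smul_add, lineMap_apply_module', invOf_eq_inv]
  module

theorem midpoint_eq_lineMap_div (q r : V) {N : ℕ} (hN : 0 < N) :
    midpoint ℝ q r = lineMap q r ((N : ℝ) / (N + N : ℕ)) := by
  rw [midpoint]
  congr 1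
  push_cast
  field_simp
  norm_num

theorem lineMap_swap_div (a c : V) {j N : ℕ} (hN : 0 < N) (hj : j ≤ N) :
    (lineMap c a ((j : ℝ) / N) : V) = lineMap a c (((N - j : ℕ) : ℝ) / N) := by
  rw [← lineMap_apply_one_sub, Nat.cast_sub hj]
  congr 1
  field_simp

namespace IsAreaPair

variable {α β A B : ℝ} {f : V → ℝ} {η : V → V → ℝ} (h : IsAreaPair K α β A B f η)
include h

/-- After the triangles `p, b j, b (j + 1)` are removed from both sides, each side is a sum of
increments of one potential `U` along a path from `(0, 0)` to `(2 * N, N)`: a staircase for the fan,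
the path through `(N, 0)` and `(N, N)` for the fans of the three pieces away from `p`. -/
theorem triSum_sum_sewTri {p q r : V} (hp : p ∈ K) (hq : q ∈ K) (hr : r ∈ K) {N : ℕ}
    (hN : 0 < N) :
    triSum (fun p q r => ∑ i ∈ Finset.range N, sewTri f η p (lineMap q r ((i : ℝ) / N))
        (lineMap q r (((i + 1 : ℕ) : ℝ) / N))) p q r =
      ∑ i ∈ Finset.range N, sewTri f η p (lineMap q r ((i : ℝ) / N))
        (lineMap q r (((i + 1 : ℕ) : ℝ) / N)) := by
  have hN' : (N : ℝ) ≠ 0 := by positivity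
  set a := midpoint ℝ p q with ha
  set c := midpoint ℝ p r with hc
  have haK : a ∈ K := h.convex.midpoint_mem hp hq
  have hcK : c ∈ K := h.convex.midpoint_mem hp hr
  set y : ℕ → V := fun i => lineMap q r ((i : ℝ) / (N + N : ℕ)) with hy
  set b : ℕ → V := fun j => lineMap a c ((j : ℝ) / N) with hb
  have hyK : ∀ i ≤ N + N, y i ∈ K := fun i hi => lineMap_div_mem h.convex hq hr hi
  have hbK : ∀ j ≤ N, b j ∈ K := fun j hj => lineMap_div_mem h.convex haK hcK hj
  -- The midline is half as long as the base, so `N` parts of the one and `2 * N` parts of the other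
  -- have the same step.
  have hpar : ∀ i j, b j + y (i + 1) = y i + b (j + 1) := by
    intro i j
    have e1 : ((i + 1 : ℕ) : ℝ) / (N + N : ℕ) = i / (N + N : ℕ) + 1 / 2 * (1 / N) := by
      push_cast
      field_simp
      ring
    have e2 : ((j + 1 : ℕ) : ℝ) / N = j / N + 1 / N := by
      push_cast
      field_simp
    simp only [hy, hb, e1, e2, ha, hc, midpoint_eq_smul_add, lineMap_apply_module', invOf_eq_inv]
    module
  have hyq : ∀ j : ℕ, (lineMap q r ((j : ℝ) / N) : V) = y (2 * j) := fun j =>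
    (lineMap_two_mul_div q r j N).symm
  have hpb : ∀ j : ℕ, midpoint ℝ p (y (2 * j)) = b j := by
    intro j
    rw [← hyq]
    simp only [hb, ha, hc, midpoint_eq_smul_add, lineMap_apply_module', invOf_eq_inv]
    module
  have hym : ∀ j : ℕ, midpoint ℝ (y (2 * j)) (y (2 * (j + 1))) = y (2 * j + 1) := by
    intro j
    rw [← hyq, ← hyq, midpoint_lineMap_div]
    simp only [hy]
    congr 3
    omega
  have hm : midpoint ℝ q r = y N := midpoint_eq_lineMap_div q r hN
  have hleft : ∀ i : ℕ, (lineMap q (y N) ((i : ℝ) / N) : V) = y i := fun i =>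
    lineMap_lineMap_left q r hN.ne' i
  have hright : ∀ i : ℕ, (lineMap (y N) r ((i : ℝ) / N) : V) = y (N + i) := fun i =>
    lineMap_lineMap_right q r hN.ne' i
  have hb0 : b 0 = a := by simp [hb]
  have hbN : b N = c := by simp [hb, hN']
  -- Exchanging the diagonal of the parallelogram on `b j, b (j + 1), y i, y (i + 1)` is exactly
  -- closedness on one cell of the grid.
  obtain ⟨U, hU1, hU2⟩ := exists_grid_potential (m := N + N) (n := N)
    (A := fun i j => sewTri f η (b j) (y i) (y (i + 1)))
    (B := fun i j => sewTri f η (y i) (b (j + 1)) (b j)) fun i hi j hj => by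
      have h1 := hbK j hj.le
      have h2 := hbK (j + 1) hj
      have h3 := hyK i hi.le
      have h4 := hyK (i + 1) hi
      have := h.sewTri_flip h1 h3 h4 h2 (hpar i j)
      rw [← h.sewTri_rotate h1 h4 h2, ← h.sewTri_rotate h1 h3 h2, h.sewTri_rotate h2 h3 h4] at this
      exact this
  -- Each fan triangle is cut by its own midlines; the three pieces away from `p` climb one stair of
  -- `U`.
  have s1 : ∀ j < N, sewTri f η p (y (2 * j)) (y (2 * (j + 1))) =
      sewTri f η p (b j) (b (j + 1)) + (U (2 * (j + 1)) (j + 1) - U (2 * j) j) := by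
    intro j hj
    rw [← h.triSum_sewTri hp (hyK _ (by omega)) (hyK _ (by omega))]
    have h1 := hU1 (2 * j) (by omega) j hj.le
    have h2 := hU1 (2 * j + 1) (by omega) (j + 1) hj
    have h3 := hU2 (2 * j + 1) j
    rw [triSum, hpb, hpb, hym]
    have e : 2 * (j + 1) = 2 * j + 1 + 1 := by ring
    rw [e]
    linarith
  have sR : ∑ i ∈ Finset.range N, sewTri f η p (lineMap q r ((i : ℝ) / N))
        (lineMap q r (((i + 1 : ℕ) : ℝ) / N)) =
      ∑ j ∈ Finset.range N, sewTri f η p (b j) (b (j + 1)) + (U (2 * N) N - U 0 0) := by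
    simp only [hyq]
    rw [Finset.sum_congr rfl fun j hj => s1 j (Finset.mem_range.1 hj), Finset.sum_add_distrib,
      Finset.sum_range_sub (fun j => U (2 * j) j)]
  have s2 : ∑ i ∈ Finset.range N, sewTri f η a (y i) (y (i + 1)) = U N 0 - U 0 0 := by
    rw [← Finset.sum_range_sub (fun i => U i 0)]
    refine Finset.sum_congr rfl fun i hi => ?_
    have := hU1 i (by have := Finset.mem_range.1 hi; omega) 0 (Nat.zero_le _)
    rwa [hb0] at this
  have s3 : ∑ i ∈ Finset.range N, sewTri f η c (y (N + i)) (y (N + (i + 1))) =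
      U (N + N) N - U N N := by
    have hU := Finset.sum_range_sub (fun i => U (N + i) N) N
    rw [add_zero] at hU
    rw [← hU]
    refine Finset.sum_congr rfl fun i hi => ?_
    have := hU1 (N + i) (by have := Finset.mem_range.1 hi; omega) N le_rfl
    rwa [hbN] at this
  -- The central piece lists `c` before `a`, so its base is run backwards and the sum has to be
  -- reflected.
  have s4 : ∑ i ∈ Finset.range N, sewTri f η (y N) (lineMap c a ((i : ℝ) / N))
      (lineMap c a (((i + 1 : ℕ) : ℝ) / N)) = U N N - U N 0 := by
    rw [← Finset.sum_range_sub (fun j => U N j), 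
      ← Finset.sum_range_reflect (fun j => U N (j + 1) - U N j)]
    refine Finset.sum_congr rfl fun i hi => ?_
    have hi := Finset.mem_range.1 hi
    have := hU2 N (N - 1 - i)
    rw [show N - 1 - i + 1 = N - i by omega] at this ⊢
    rw [lineMap_swap_div a c hN hi.le, lineMap_swap_div a c hN hi,
      show N - (i + 1) = N - 1 - i by omega]
    exact this
  rw [sR]
  simp only [triSum, ← ha, ← hc, hm, hleft, hright]
  rw [s2, s3, s4, two_mul]
  ring

/-- The defect is invariant by `triSum_sum_sewTri`, and of order `α + β` by telescoping: for each
tetrahedron of the fan the face on the line `q r` contributes nothing. -/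
theorem sewTri_eq_sum {p q r : V} (hp : p ∈ K) (hq : q ∈ K) (hr : r ∈ K) {N : ℕ} (hN : 0 < N) :
    sewTri f η p q r = ∑ i ∈ Finset.range N, sewTri f η p (lineMap q r ((i : ℝ) / N))
      (lineMap q r (((i + 1 : ℕ) : ℝ) / N)) := by
  have hN' : (N : ℝ) ≠ 0 := by positivity
  have := eq_zero_of_triSum_eq h.convex h.two_lt (c := N * coboundaryConst α β A B)
    (G := fun p q r => sewTri f η p q r - ∑ i ∈ Finset.range N,
      sewTri f η p (lineMap q r ((i : ℝ) / N)) (lineMap q r (((i + 1 : ℕ) : ℝ) / N)))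
    (fun p hp q hq r hr => ?_) (fun p hp q hq r hr ε hpq hqr hpr => ?_) hp hq hr
  · exact sub_eq_zero.1 this
  · have h1 := h.triSum_sewTri hp hq hr
    have h2 := h.triSum_sum_sewTri hp hq hr hN
    simp only [triSum] at h1 h2 ⊢
    linarith
  · have key := abs_sub_sum_range_le (sewTri f η p) (fun i => lineMap q r ((i : ℝ) / N))
      (coboundaryConst α β A B * ε ^ (α + β)) ?_ N fun i hi => ?_
    · simpa [hN', mul_assoc] using key
    · exact h.sewTri_collinear hp (by simpa using hq) (by simpa using hq)
        (by simp [collinear_pair])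
    · have m0 := lineMap_div_mem h.convex hq hr (Nat.zero_le N)
      have m1 := lineMap_div_mem h.convex hq hr hi.le
      have m2 := lineMap_div_mem h.convex hq hr (Nat.succ_le_of_lt hi)
      have hd : ∀ i ≤ N, dist p (lineMap q r ((i : ℝ) / N) : V) ≤ ε := fun i hi =>
        dist_le_of_mem_segment hpq hpr (lineMap_div_mem_segment q r hi)
      have d1 := (dist_lineMap_div_le q r (Nat.zero_le N) hi.le).trans hqr
      have d2 := (dist_lineMap_div_le q r hi.le (Nat.succ_le_of_lt hi)).trans hqr
      have d3 := (dist_lineMap_div_le q r (Nat.zero_le N) (Nat.succ_le_of_lt hi)).trans hqr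
      have := h.coboundary_sewTri_le hp m0 m1 m2 (hd _ (Nat.zero_le N)) (hd _ hi.le)
        (hd _ (Nat.succ_le_of_lt hi)) d1 d3 d2
      rw [h.sewTri_collinear m0 m1 m2, zero_sub] at this
      · refine le_trans (le_of_eq ?_) this
        congr 1
        simp only [Nat.succ_eq_add_one]
        ring
      · exact collinear_triple_of_mem_affineSpan_pair
          (AffineMap.lineMap_mem_affineSpan_pair _ _ _)
          (AffineMap.lineMap_mem_affineSpan_pair _ _ _)
          (AffineMap.lineMap_mem_affineSpan_pair _ _ _)

/-- `sewTri f η` is additive when a triangle is cut from a vertex. -/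
theorem sewTri_add {p q r z : V} (hp : p ∈ K) (hq : q ∈ K) (hr : r ∈ K)
    (hz : z ∈ segment ℝ q r) : sewTri f η p q z + sewTri f η p z r = sewTri f η p q r :=
  add_eq_of_sum_eq (φ := sewTri f η p) h.convex
    (h.continuousOn_sewTri.comp (f := fun x : V × V => (p, x)) (by fun_prop)
      fun x hx => ⟨hp, hx.1, hx.2⟩)
    (fun x hx => h.sewTri_collinear hp hx hx (by simp [collinear_pair]))
    (fun x hx y hy N hN => h.sewTri_eq_sum hp hx hy hN) hq hr hz

/-- The ray from `q` through `p` meets the opposite side at `z`; four cuts along that ray give the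
relation, up to reordering vertices. -/
theorem sewTri_closed_of_mem_triangle {p q r s : V} (hq : q ∈ K) (hr : r ∈ K)
    (hs : s ∈ K) (hmem : p ∈ convexHull ℝ {q, r, s}) :
    sewTri f η q r s - sewTri f η p r s + sewTri f η p q s - sewTri f η p q r = 0 := by
  rw [convexHull_insert (by simp), convexHull_pair] at hmem
  obtain ⟨q', hq', z, hz, hpz⟩ := mem_convexJoin.1 hmem
  obtain rfl : q' = q := hq'
  have hzK : z ∈ K := h.convex.segment_subset hr hs hz
  have hp : p ∈ K := h.convex.segment_subset hq hzK hpz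
  have h1 := h.sewTri_add hq hr hs hz
  have h2 := h.sewTri_add hp hr hs hz
  have h3 := h.sewTri_add hr hq hzK hpz
  have h4 := h.sewTri_add hs hq hzK hpz
  linarith [h.sewTri_rotate hq hr hzK, h.sewTri_rotate hr hq hzK, h.sewTri_rotate hzK hq hr,
    h.sewTri_swap hq hr hzK, h.sewTri_rotate hs hq hzK, h.sewTri_swap hs hq hzK,
    h.sewTri_rotate hq hzK hs, h.sewTri_rotate hr hq hp, h.sewTri_rotate hq hp hr,
    h.sewTri_swap hp hq hr,
    h.sewTri_rotate hr hp hzK, h.sewTri_rotate hp hzK hr, h.sewTri_swap hp hr hzK,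
    h.sewTri_rotate hs hq hp, h.sewTri_rotate hq hp hs, h.sewTri_swap hp hq hs,
    h.sewTri_rotate hs hp hzK, h.sewTri_rotate hp hzK hs, h.sewTri_swap hp hs hzK]

/-- Cut the four faces at the crossing point `x` of the diagonals. -/
theorem sewTri_closed_of_segments {p q r s x : V} (hp : p ∈ K) (hq : q ∈ K) (hr : r ∈ K)
    (hs : s ∈ K) (hpq : x ∈ segment ℝ p q) (hrs : x ∈ segment ℝ r s) :
    sewTri f η q r s - sewTri f η p r s + sewTri f η p q s - sewTri f η p q r = 0 := by
  have hx : x ∈ K := h.convex.segment_subset hp hq hpq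
  have h1 := h.sewTri_add hp hr hs hrs
  have h2 := h.sewTri_add hq hr hs hrs
  have h3 := h.sewTri_add hr hp hq hpq
  have h4 := h.sewTri_add hs hp hq hpq
  linarith [h.sewTri_rotate hr hp hq, h.sewTri_rotate hs hp hq,
    h.sewTri_rotate hr hp hx, h.sewTri_rotate hp hx hr, h.sewTri_swap hp hr hx,
    h.sewTri_rotate hr hx hq, h.sewTri_rotate hx hq hr, h.sewTri_swap hq hr hx,
    h.sewTri_rotate hs hp hx, h.sewTri_rotate hp hx hs, h.sewTri_swap hp hs hx,
    h.sewTri_rotate hs hx hq, h.sewTri_rotate hx hq hs, h.sewTri_swap hq hs hx]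

theorem sewTri_swap_left {p q r : V} (hp : p ∈ K) (hq : q ∈ K) (hr : r ∈ K) :
    sewTri f η q p r = -sewTri f η p q r := by
  rw [← h.sewTri_rotate hq hp hr, h.sewTri_swap hp hq hr]

/-- `sewTri f η` is closed on planes. -/
theorem sewTri_closed {x : Fin 4 → V} (hx : ∀ i, x i ∈ K) (hdep : ¬AffineIndependent ℝ x) :
    sewTri f η (x 1) (x 2) (x 3) - sewTri f η (x 0) (x 2) (x 3) + sewTri f η (x 0) (x 1) (x 3) -
      sewTri f η (x 0) (x 1) (x 2) = 0 := by
  have r123 := h.sewTri_rotate (hx 1) (hx 2) (hx 3)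
  have r023 := h.sewTri_rotate (hx 0) (hx 2) (hx 3)
  have r013 := h.sewTri_rotate (hx 0) (hx 1) (hx 3)
  have r012 := h.sewTri_rotate (hx 0) (hx 1) (hx 2)
  have q123 := h.sewTri_rotate (hx 2) (hx 3) (hx 1)
  have q023 := h.sewTri_rotate (hx 2) (hx 3) (hx 0)
  have q013 := h.sewTri_rotate (hx 1) (hx 3) (hx 0)
  have q012 := h.sewTri_rotate (hx 1) (hx 2) (hx 0)
  have s123 := h.sewTri_swap (hx 1) (hx 2) (hx 3)
  have s023 := h.sewTri_swap (hx 0) (hx 2) (hx 3)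
  have s013 := h.sewTri_swap (hx 0) (hx 1) (hx 3)
  have s012 := h.sewTri_swap (hx 0) (hx 1) (hx 2)
  have u123 := h.sewTri_swap_left (hx 1) (hx 2) (hx 3)
  have u023 := h.sewTri_swap_left (hx 0) (hx 2) (hx 3)
  have u013 := h.sewTri_swap_left (hx 0) (hx 1) (hx 3)
  have u012 := h.sewTri_swap_left (hx 0) (hx 1) (hx 2)
  have t0 : x 0 ∈ convexHull ℝ {x 1, x 2, x 3} → _ :=
    h.sewTri_closed_of_mem_triangle (hx 1) (hx 2) (hx 3)
  have t1 : x 1 ∈ convexHull ℝ {x 0, x 2, x 3} → _ :=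
    h.sewTri_closed_of_mem_triangle (hx 0) (hx 2) (hx 3)
  have t2 : x 2 ∈ convexHull ℝ {x 0, x 1, x 3} → _ :=
    h.sewTri_closed_of_mem_triangle (hx 0) (hx 1) (hx 3)
  have t3 : x 3 ∈ convexHull ℝ {x 0, x 1, x 2} → _ :=
    h.sewTri_closed_of_mem_triangle (hx 0) (hx 1) (hx 2)
  -- The Radon partitions with `0 ∈ I`: a point inside the triangle of the other three, or two
  -- crossing segments. An empty complement is excluded by its empty hull.
  have key : ∀ I : Set (Fin 4), 0 ∈ I →
      (convexHull ℝ (x '' I) ∩ convexHull ℝ (x '' Iᶜ)).Nonempty →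
      sewTri f η (x 1) (x 2) (x 3) - sewTri f η (x 0) (x 2) (x 3) +
        sewTri f η (x 0) (x 1) (x 3) - sewTri f η (x 0) (x 1) (x 2) = 0 := by
    rintro I h0 ⟨z, hz1, hz2⟩
    have sub : ∀ S T : Set V, (∀ i ∈ I, x i ∈ S) → (∀ i ∈ Iᶜ, x i ∈ T) →
        z ∈ convexHull ℝ S ∧ z ∈ convexHull ℝ T :=
      fun S T hS hT => ⟨convexHull_mono (Set.image_subset_iff.2 hS) hz1,
        convexHull_mono (Set.image_subset_iff.2 hT) hz2⟩
    by_cases h1 : 1 ∈ I <;> by_cases h2 : 2 ∈ I <;> by_cases h3 : 3 ∈ I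
    · have : Iᶜ = ∅ := by ext i; fin_cases i <;> simp_all
      simp [this] at hz2
    · obtain ⟨ha, hb⟩ := sub {x 0, x 1, x 2} {x 3}
        (by simp [Fin.forall_fin_succ, h0, h1, h2, h3])
        (by simp [Fin.forall_fin_succ, h0, h1, h2, h3])
      rw [convexHull_singleton, Set.mem_singleton_iff] at hb
      have := t3 (hb ▸ ha)
      linarith
    · obtain ⟨ha, hb⟩ := sub {x 0, x 1, x 3} {x 2}
        (by simp [Fin.forall_fin_succ, h0, h1, h2, h3])
        (by simp [Fin.forall_fin_succ, h0, h1, h2, h3])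
      rw [convexHull_singleton, Set.mem_singleton_iff] at hb
      have := t2 (hb ▸ ha)
      linarith
    · obtain ⟨ha, hb⟩ := sub {x 0, x 1} {x 2, x 3}
        (by simp [Fin.forall_fin_succ, h0, h1, h2, h3])
        (by simp [Fin.forall_fin_succ, h0, h1, h2, h3])
      rw [convexHull_pair] at ha hb
      have := h.sewTri_closed_of_segments (hx 0) (hx 1) (hx 2) (hx 3) ha hb
      linarith
    · obtain ⟨ha, hb⟩ := sub {x 0, x 2, x 3} {x 1}
        (by simp [Fin.forall_fin_succ, h0, h1, h2, h3])
        (by simp [Fin.forall_fin_succ, h0, h1, h2, h3])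
      rw [convexHull_singleton, Set.mem_singleton_iff] at hb
      have := t1 (hb ▸ ha)
      linarith
    · obtain ⟨ha, hb⟩ := sub {x 0, x 2} {x 1, x 3}
        (by simp [Fin.forall_fin_succ, h0, h1, h2, h3])
        (by simp [Fin.forall_fin_succ, h0, h1, h2, h3])
      rw [convexHull_pair] at ha hb
      have := h.sewTri_closed_of_segments (hx 0) (hx 2) (hx 1) (hx 3) ha hb
      linarith
    · obtain ⟨ha, hb⟩ := sub {x 0, x 3} {x 1, x 2}
        (by simp [Fin.forall_fin_succ, h0, h1, h2, h3])
        (by simp [Fin.forall_fin_succ, h0, h1, h2, h3])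
      rw [convexHull_pair] at ha hb
      have := h.sewTri_closed_of_segments (hx 0) (hx 3) (hx 1) (hx 2) ha hb
      linarith
    · obtain ⟨ha, hb⟩ := sub {x 0} {x 1, x 2, x 3}
        (by simp [Fin.forall_fin_succ, h0, h1, h2, h3])
        (by simp [Fin.forall_fin_succ, h0, h1, h2, h3])
      rw [convexHull_singleton, Set.mem_singleton_iff] at ha
      have := t0 (ha ▸ hb)
      linarith
  obtain ⟨I, hI⟩ := Convex.radon_partition hdep
  by_cases h0 : 0 ∈ I
  · exact key I h0 hI
  · exact key Iᶜ h0 (by rwa [compl_compl, Set.inter_comm])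

end IsAreaPair

end Closed

end

section

open Filter Topology
open scoped NNReal ENNReal

variable {d : ℕ} {D K : Set (E d)}

/-! ### Simplices, brackets and Dini gauges. -/

section Basic

theorem Simp.dist_le_diam {k : ℕ} (S : Simp D k) (i j : Fin (k + 1)) :
    dist (S.1 i) (S.1 j) ≤ S.diam :=
  Metric.dist_le_diam_of_mem (Set.finite_range _).isBounded ⟨i, rfl⟩ ⟨j, rfl⟩

theorem Simp.diam_nonneg {k : ℕ} (S : Simp D k) : 0 ≤ S.diam := Metric.diam_nonneg

theorem Simp.diam_le {k : ℕ} (S : Simp D k) {ε : ℝ} (hε : 0 ≤ ε)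
    (h : ∀ i j, dist (S.1 i) (S.1 j) ≤ ε) : S.diam ≤ ε := by
  refine Metric.diam_le_of_forall_dist_le hε ?_
  rintro _ ⟨i, rfl⟩ _ ⟨j, rfl⟩
  exact h i j

theorem Simp.mem_convexHull {k : ℕ} (S : Simp D k) (i : Fin (k + 1)) :
    S.1 i ∈ convexHull ℝ (Set.range S.1) :=
  subset_convexHull ℝ _ ⟨i, rfl⟩

/-- The simplex on given vertices of a convex subset of `D`. -/
def Simp.ofMem (hK : Convex ℝ K) (hKD : K ⊆ D) {k : ℕ} (x : Fin (k + 1) → E d)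
    (hx : ∀ i, x i ∈ K) : Simp D k :=
  ⟨x, (convexHull_min (Set.range_subset_iff.2 hx) hK).trans hKD⟩

theorem abs_le_toReal_bracket {k : ℕ} {v ω : Germ D k} (hv : ∀ S, 0 ≤ v S)
    (h : bracket v ω < ∞) (S : Simp D k) : |ω S| ≤ (bracket v ω).toReal * v S := by
  refine le_of_forall_pos_le_add fun ε hε => ?_
  -- The `+ 1` allows for `v S = 0`.
  have hpos : 0 < ε / (v S + 1) := div_pos hε (by linarith [hv S])
  have hlt : bracket v ω < ENNReal.ofReal ((bracket v ω).toReal + ε / (v S + 1)) := by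
    rw [← ENNReal.toReal_lt_toReal h.ne ENNReal.ofReal_ne_top,
      ENNReal.toReal_ofReal (by positivity)]
    linarith
  obtain ⟨c, hc⟩ := iInf_lt_iff.1 hlt
  obtain ⟨hcω, hc⟩ := iInf_lt_iff.1 hc
  have hc' : (c : ℝ) ≤ (bracket v ω).toReal + ε / (v S + 1) := by
    have h2 := (ENNReal.toReal_lt_toReal ENNReal.coe_ne_top ENNReal.ofReal_ne_top).2 hc
    rw [ENNReal.toReal_ofReal (by positivity)] at h2
    exact h2.le
  have hε' : ε / (v S + 1) * v S ≤ ε := by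
    rw [div_mul_eq_mul_div, div_le_iff₀ (by linarith [hv S])]
    nlinarith [hv S]
  calc |ω S| ≤ c * v S := hcω S
    _ ≤ ((bracket v ω).toReal + ε / (v S + 1)) * v S := by
      have := hv S
      gcongr
    _ ≤ _ := by linarith

theorem bracket_le {k : ℕ} {v ω : Germ D k} (c : ℝ≥0) (h : ∀ S, |ω S| ≤ c * v S) :
    bracket v ω ≤ c :=
  iInf₂_le c h

theorem diamPow_nonneg (k : ℕ) (γ : ℝ) (S : Simp D k) : 0 ≤ diamPow D k γ S :=
  Real.rpow_nonneg S.diam_nonneg γ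

theorem Simp.diam_shrink_le {k : ℕ} (S : Simp D k) (n : ℕ) :
    (S.shrink n).diam ≤ (1 / 2 : ℝ) ^ n * S.diam := by
  refine Simp.diam_le _ (mul_nonneg (by positivity) S.diam_nonneg) fun i j => ?_
  simp only [Simp.shrink, dist_add_left]
  rw [dist_smul₀, dist_sub_right, Real.norm_eq_abs, abs_of_pos (by positivity)]
  gcongr
  exact S.dist_le_diam i j

theorem isDiniGauge_diamPow {k : ℕ} {γ r : ℝ} (hγ : r < γ) (hγ0 : 0 ≤ γ) :
    IsDiniGauge r (diamPow D k γ) where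
  nonneg := diamPow_nonneg k γ
  uniform S T hST := by
    obtain ⟨ι, hι, h⟩ := hST
    have : Set.range T.1 = ι '' Set.range S.1 := by
      rw [← Set.range_comp]
      exact congrArg Set.range (funext fun j => (h j).symm)
    rw [diamPow, diamPow, Simp.diam, Simp.diam, this, hι.diam_image]
  tendsto_zero S := by
    have lim : Tendsto (fun n : ℕ => ((2 : ℝ) ^ (r - γ)) ^ n * S.diam ^ γ) atTop
        (𝓝 (0 * S.diam ^ γ)) :=
      (tendsto_pow_atTop_nhds_zero_of_lt_one (by positivity)
        (Real.rpow_lt_one_of_one_lt_of_neg (by norm_num) (by linarith))).mul_const _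
    rw [zero_mul] at lim
    refine squeeze_zero (fun n => mul_nonneg (by positivity) (diamPow_nonneg k γ _))
      (fun n => ?_) lim
    have h1 : diamPow D k γ (S.shrink n) ≤ ((1 / 2 : ℝ) ^ n * S.diam) ^ γ :=
      Real.rpow_le_rpow (Simp.diam_nonneg _) (S.diam_shrink_le n) hγ0
    refine (mul_le_mul_of_nonneg_left h1 (by positivity)).trans (le_of_eq ?_)
    rw [Real.mul_rpow (by positivity) S.diam_nonneg, ← mul_assoc, one_div, inv_pow,
      ← Real.rpow_natCast 2 n, ← Real.rpow_neg (by norm_num), ← Real.rpow_mul (by norm_num),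
      ← Real.rpow_add (by norm_num), ← Real.rpow_natCast, ← Real.rpow_mul (by norm_num)]
    congr 2
    ring

theorem IsDiniGauge.add {k : ℕ} {r : ℝ} {v w : Germ D k} (hv : IsDiniGauge r v)
    (hw : IsDiniGauge r w) : IsDiniGauge r (v + w) where
  nonneg S := add_nonneg (hv.nonneg S) (hw.nonneg S)
  uniform S T h := by simp only [Pi.add_apply, hv.uniform S T h, hw.uniform S T h]
  tendsto_zero S := by
    have := (hv.tendsto_zero S).add (hw.tendsto_zero S)
    simpa only [Pi.add_apply, mul_add, add_zero] using this

theorem IsDiniGauge.const_mul {k : ℕ} {r : ℝ} {v : Germ D k} (hv : IsDiniGauge r v) {c : ℝ}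
    (hc : 0 ≤ c) : IsDiniGauge r (fun S => c * v S) where
  nonneg S := mul_nonneg hc (hv.nonneg S)
  uniform S T h := by simp only [hv.uniform S T h]
  tendsto_zero S := by
    have := (hv.tendsto_zero S).const_mul c
    simpa only [mul_zero, mul_left_comm c] using this

theorem delta_sub {k : ℕ} (ω η : Germ D k) : delta (ω - η) = delta ω - delta η := by
  funext S
  simp [delta, mul_sub, Finset.sum_sub_distrib]

theorem IsRegular.sub {k : ℕ} {ω η : Germ D k} (hω : IsRegular ω) (hη : IsRegular η) :
    IsRegular (ω - η) := by
  refine ⟨fun S hS => by simp [hω.1 S hS, hη.1 S hS], fun I φ h => ?_⟩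
  have : pullback φ h (ω - η) = pullback φ h ω - pullback φ h η := rfl
  rw [this, delta_sub, hω.2 I φ h, hη.2 I φ h, sub_self]

/-- A germ which is closed on planes is closed on simplices with vertices in the convex
envelope of a simplex. -/
theorem IsClosedOnPlanes.delta_eq_zero {k : ℕ} {ω : Germ D k} (hω : IsClosedOnPlanes ω)
    (S : Simp D k) (T : Simp D (k + 1)) (hT : ∀ i, T.1 i ∈ convexHull ℝ (Set.range S.1)) :
    delta ω T = 0 := by
  -- The map `φ` carries the standard simplex of `ℝ ^ k` onto the hull of `S`, even when `S` is
  -- degenerate, so the vertices of `T` lift to `ℝ ^ k`.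
  let L : E k →ₗ[ℝ] E d := (Fintype.linearCombination ℝ fun i : Fin k => S.1 i.succ - S.1 0) ∘ₗ
    (WithLp.linearEquiv 2 ℝ (Fin k → ℝ)).toLinearMap
  let φ : E k →ᵃ[ℝ] E d := L.toAffineMap + AffineMap.const ℝ (E k) (S.1 0)
  have hφ : convexHull ℝ (Set.range S.1) ⊆ φ '' Set.univ := by
    refine convexHull_min ?_ (convex_univ.affine_image φ)
    rintro _ ⟨i, rfl⟩
    refine Fin.cases ⟨0, trivial, ?_⟩ (fun i => ⟨WithLp.toLp 2 (Pi.single i 1), trivial, ?_⟩) i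
    · simp [φ]
    · simp [φ, L, Fintype.linearCombination_apply_single]
  choose y _ hy using fun i => hφ (hT i)
  have hI : Set.MapsTo φ (convexHull ℝ (Set.range y)) D := by
    rw [Set.mapsTo_iff_image_subset, AffineMap.image_convexHull, ← Set.range_comp]
    have : (φ ∘ y) = T.1 := funext hy
    rw [this]
    exact T.2
  have h := congrFun (hω _ φ hI) ⟨y, subset_rfl⟩
  have e : (⟨T.1, T.2⟩ : Simp D (k + 1)) =
      Simp.map φ hI (⟨y, subset_rfl⟩ : Simp (convexHull ℝ (Set.range y)) (k + 1)) :=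
    Subtype.ext (funext fun i => (hy i).symm)
  change delta ω ⟨T.1, T.2⟩ = 0
  rw [e]
  exact h

end Basic

/-! ### Simplices of zero volume. -/

section Volume

theorem Simp.eq_of_vol_eq_zero (S : Simp D 1) (h : S.vol = 0) : S.1 1 = S.1 0 := by
  simp only [Simp.vol, Nat.factorial, Matrix.det_unique, Matrix.mul_apply] at h
  simp only [Matrix.transpose_apply, Matrix.of_apply, Nat.cast_one, Nat.succ_eq_add_one,
    mul_one, zero_add, div_one, one_mul] at h
  rw [Real.sqrt_eq_zero (Finset.sum_nonneg fun i _ => mul_self_nonneg _),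
    Finset.sum_eq_zero_iff_of_nonneg fun i _ => mul_self_nonneg _] at h
  ext j
  have := mul_self_eq_zero.1 (h j (Finset.mem_univ j))
  simpa [sub_eq_zero] using this

theorem Simp.vol_eq (S : Simp D 2) : S.vol = 1 / 2 * √(‖S.1 1 - S.1 0‖ ^ 2 * ‖S.1 2 - S.1 0‖ ^ 2 -
    inner ℝ (S.1 1 - S.1 0) (S.1 2 - S.1 0) ^ 2) := by
  have key : ∀ x y : E d, ∑ j, x j * y j = inner ℝ x y := fun x y => by
    simp only [PiLp.inner_apply, RCLike.inner_apply, conj_trivial, mul_comm]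
  simp only [Simp.vol, Matrix.det_fin_two, Matrix.mul_apply, Matrix.transpose_apply,
    Matrix.of_apply, key, ← real_inner_self_eq_norm_sq, Fin.succ_zero_eq_one, Fin.succ_one_eq_two,
    Nat.factorial]
  rw [real_inner_comm (S.1 1 - S.1 0) (S.1 2 - S.1 0), ← sq]
  norm_num
  congr 1
  ring

/-- A vanishing Gram determinant is equality in the Cauchy–Schwarz inequality. -/
theorem Simp.collinear_of_vol_eq_zero (S : Simp D 2) (h : S.vol = 0) :
    Collinear ℝ {S.1 0, S.1 1, S.1 2} := by
  set u := S.1 1 - S.1 0 with hu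
  set v := S.1 2 - S.1 0 with hv
  rw [S.vol_eq, ← hu, ← hv] at h
  have hcs := abs_real_inner_le_norm u v
  have h0 : 0 ≤ ‖u‖ ^ 2 * ‖v‖ ^ 2 - inner ℝ u v ^ 2 := by
    have := pow_le_pow_left₀ (abs_nonneg _) hcs 2
    rw [sq_abs, mul_pow] at this
    linarith
  rw [mul_eq_zero_iff_left (by norm_num), Real.sqrt_eq_zero h0] at h
  refine (collinear_iff_of_mem (k := ℝ) (p₀ := S.1 0) (by simp)).2 ?_
  by_cases hu0 : u = 0
  · refine ⟨v, ?_⟩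
    rintro x (rfl | rfl | rfl)
    · exact ⟨0, by simp⟩
    · exact ⟨0, by simpa using sub_eq_zero.1 (hu.symm.trans hu0)⟩
    · exact ⟨1, by simp [hv]⟩
  · by_cases hv0 : v = 0
    · refine ⟨u, ?_⟩
      rintro x (rfl | rfl | rfl)
      · exact ⟨0, by simp⟩
      · exact ⟨1, by simp [hu]⟩
      · exact ⟨0, by simpa using sub_eq_zero.1 (hv.symm.trans hv0)⟩
    · have hn : ‖inner ℝ u v‖ = ‖u‖ * ‖v‖ := by
        rw [Real.norm_eq_abs, ← abs_of_nonneg (mul_nonneg (norm_nonneg u) (norm_nonneg v)),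
          ← sq_eq_sq_iff_abs_eq_abs]
        linarith [mul_pow ‖u‖ ‖v‖ 2]
      obtain ⟨r, -, hr⟩ := (norm_inner_eq_norm_iff (𝕜 := ℝ) hu0 hv0).1 hn
      refine ⟨u, ?_⟩
      rintro x (rfl | rfl | rfl)
      · exact ⟨0, by simp⟩
      · exact ⟨1, by simp [hu]⟩
      · exact ⟨r, by rw [← hr, hv]; simp⟩

theorem Simp.vol_eq_zero_of_collinear (S : Simp D 2) (h : Collinear ℝ {S.1 0, S.1 1, S.1 2}) :
    S.vol = 0 := by
  obtain ⟨v, hv⟩ := (collinear_iff_of_mem (k := ℝ) (p₀ := S.1 0) (by simp)).1 h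
  obtain ⟨s, hs⟩ := hv (S.1 1) (by simp)
  obtain ⟨t, ht⟩ := hv (S.1 2) (by simp)
  rw [S.vol_eq, hs, ht]
  simp only [vadd_eq_add, add_sub_cancel_right, real_inner_smul_left, real_inner_smul_right,
    norm_smul, mul_pow, Real.norm_eq_abs, sq_abs, real_inner_self_eq_norm_sq]
  rw [mul_eq_zero_iff_left (by norm_num), Real.sqrt_eq_zero_of_nonpos]
  exact le_of_eq (by ring)

end Volume

end

section

open Filter Topology
open scoped NNReal ENNReal

variable {d : ℕ} {D K : Set (E d)}

/-! ### Germs as functions of tuples of points. -/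

section Extension

open Classical in
/-- A germ as a function of all tuples of points, with value `0` at those which are not
simplices in `D`. -/
noncomputable def extend {k : ℕ} (ω : Germ D k) (x : Fin (k + 1) → E d) : ℝ :=
  if h : convexHull ℝ (Set.range x) ⊆ D then ω ⟨x, h⟩ else 0

theorem extend_apply {k : ℕ} (ω : Germ D k) (S : Simp D k) : extend ω S.1 = ω S :=
  dif_pos S.2

theorem delta_apply_zero (f : Germ D 0) (T : Simp D 1) :
    delta f T = extend f ![T.1 1] - extend f ![T.1 0] := by
  have h1 : (T.sub (Fin.succAbove 0)).1 = ![T.1 1] := by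
    funext i; fin_cases i; rfl
  have h2 : (T.sub (Fin.succAbove 1)).1 = ![T.1 0] := by
    funext i; fin_cases i; rfl
  rw [← h1, ← h2, extend_apply, extend_apply, delta, Fin.sum_univ_two]
  simp
  ring

theorem delta_apply_one (ω : Germ D 1) (T : Simp D 2) :
    delta ω T = extend ω ![T.1 1, T.1 2] - extend ω ![T.1 0, T.1 2] +
      extend ω ![T.1 0, T.1 1] := by
  have h1 : (T.sub (Fin.succAbove 0)).1 = ![T.1 1, T.1 2] := by
    funext i; fin_cases i <;> rfl
  have h2 : (T.sub (Fin.succAbove 1)).1 = ![T.1 0, T.1 2] := by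
    funext i; fin_cases i <;> rfl
  have h3 : (T.sub (Fin.succAbove 2)).1 = ![T.1 0, T.1 1] := by
    funext i; fin_cases i <;> rfl
  rw [← h1, ← h2, ← h3, extend_apply, extend_apply, extend_apply, delta, Fin.sum_univ_three]
  simp
  ring

theorem delta_apply_two (ω : Germ D 2) (T : Simp D 3) :
    delta ω T = extend ω ![T.1 1, T.1 2, T.1 3] - extend ω ![T.1 0, T.1 2, T.1 3] +
      extend ω ![T.1 0, T.1 1, T.1 3] - extend ω ![T.1 0, T.1 1, T.1 2] := by
  have h1 : (T.sub (Fin.succAbove 0)).1 = ![T.1 1, T.1 2, T.1 3] := by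
    funext i; fin_cases i <;> rfl
  have h2 : (T.sub (Fin.succAbove 1)).1 = ![T.1 0, T.1 2, T.1 3] := by
    funext i; fin_cases i <;> rfl
  have h3 : (T.sub (Fin.succAbove 2)).1 = ![T.1 0, T.1 1, T.1 3] := by
    funext i; fin_cases i <;> rfl
  have h4 : (T.sub (Fin.succAbove 3)).1 = ![T.1 0, T.1 1, T.1 2] := by
    funext i; fin_cases i <;> rfl
  rw [← h1, ← h2, ← h3, ← h4, extend_apply, extend_apply, extend_apply, extend_apply, delta,
    Fin.sum_univ_four]
  simp [pow_succ]
  ring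

theorem continuousOn_extend {f : Germ D 0} (hf : Continuous f) :
    ContinuousOn (fun x => extend f ![x]) D := by
  rw [continuousOn_iff_continuous_domRestrict]
  have hr : ∀ x : E d, Set.range ![x] = {x} := fun x => by simp
  have hmem : ∀ x : D, convexHull ℝ (Set.range ![(x : E d)]) ⊆ D := fun x => by
    rw [hr, convexHull_singleton]
    exact Set.singleton_subset_iff.2 x.2
  have : D.domRestrict (fun x => extend f ![x]) = fun x : D => f ⟨![(x : E d)], hmem x⟩ :=
    funext fun x => extend_apply f ⟨![(x : E d)], hmem x⟩
  rw [this]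
  refine hf.comp (Continuous.subtype_mk ?_ _)
  refine continuous_pi fun i => ?_
  fin_cases i
  exact continuous_subtype_val

end Extension

/-! ### Uniqueness of the regular germ. -/

section Uniqueness

/-- The isometry scales by `u * 2 ^ n = ± 1`. The negative sign is needed for central pieces of
triangles. -/
theorem Simp.isometric_shrink {k : ℕ} (S T : Simp D k) (n : ℕ) {u : ℝ}
    (hu : |u| = (1 / 2 : ℝ) ^ n) (h : ∀ j, T.1 j - T.1 0 = u • (S.1 j - S.1 0)) :
    (S.shrink n).Isometric T := by
  have h2 : |u * 2 ^ n| = 1 := by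
    rw [abs_mul, hu, abs_of_pos (by positivity : (0 : ℝ) < 2 ^ n), ← mul_pow]
    norm_num
  refine ⟨fun z => T.1 0 + (u * 2 ^ n) • (z - S.1 0), Isometry.of_dist_eq fun x y => ?_, fun j => ?_⟩
  · rw [dist_add_left, dist_smul₀, dist_sub_right, Real.norm_eq_abs, h2, one_mul]
  · have e : u * 2 ^ n * (1 / 2 : ℝ) ^ n = u := by
      rw [mul_assoc, ← mul_pow]
      norm_num
    simp only [Simp.shrink, add_sub_cancel_left, smul_smul, e, ← h]
    abel

theorem eq_zero_of_le_isDiniGauge_one {H w : Germ D 1} (hH : IsRegular H)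
    (hw : IsDiniGauge (1 : ℕ) w) (hHw : ∀ S, |H S| ≤ w S) : H = 0 := by
  funext S
  have hK := convex_convexHull ℝ (Set.range S.1)
  have hadd : ∀ x ∈ convexHull ℝ (Set.range S.1) ×ˢ convexHull ℝ (Set.range S.1),
      refine segPiece (fun x : E d × E d => extend H ![x.1, x.2]) x = extend H ![x.1, x.2] := by
    intro x hx
    have hm := hK.midpoint_mem hx.1 hx.2
    have hmem : ∀ i, ![x.1, midpoint ℝ x.1 x.2, x.2] i ∈ convexHull ℝ (Set.range S.1) := by
      simpa [Fin.forall_fin_succ] using ⟨hx.1, hm, hx.2⟩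
    have := hH.2.delta_eq_zero S (Simp.ofMem hK S.2 _ hmem) hmem
    rw [delta_apply_one] at this
    simp only [Simp.ofMem, Matrix.cons_val] at this
    rw [refine_segPiece]
    linarith
  have key : ∀ n : ℕ, |H S| ≤ 2 ^ ((n : ℝ) * (1 : ℕ)) * w (S.shrink n) := by
    intro n
    have := abs_refine_iterate_le (s := segPiece) (ω := fun x : E d × E d => extend H ![x.1, x.2])
      (Q := fun n => {y | y ∈ convexHull ℝ (Set.range S.1) ×ˢ convexHull ℝ (Set.range S.1) ∧
        y.2 - y.1 = (1 / 2 : ℝ) ^ n • (S.1 1 - S.1 0)}) (w := w (S.shrink n))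
      (fun k i y hy => ⟨(isSubdivision_segPiece hK).mem i y hy.1, ?_⟩) n 0 (fun y hy => ?_)
      (x := (S.1 0, S.1 1)) ⟨⟨S.mem_convexHull 0, S.mem_convexHull 1⟩, by simp⟩
    · rw [refine_iterate_eq_of_refine_eq (isSubdivision_segPiece hK).mem hadd n
        ⟨S.mem_convexHull 0, S.mem_convexHull 1⟩] at this
      have e : ![S.1 0, S.1 1] = S.1 := by funext i; fin_cases i <;> rfl
      simpa [e, extend_apply] using this
    · rw [pow_succ, mul_comm, mul_smul, ← hy.2]
      fin_cases i
      all_goals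
        simp only [segPiece, midpoint_eq_smul_add, invOf_eq_inv]
        simp
        module
    · have hmem : ∀ i, ![y.1, y.2] i ∈ convexHull ℝ (Set.range S.1) := by
        simpa [Fin.forall_fin_succ] using hy.1
      have e := extend_apply H (Simp.ofMem hK S.2 _ hmem)
      simp only [Simp.ofMem] at e
      rw [e, hw.uniform _ _ (S.isometric_shrink (Simp.ofMem hK S.2 _ hmem) n (u := (1 / 2) ^ n)
        (abs_of_pos (by positivity)) ?_)]
      · exact hHw _
      · have := hy.2
        rw [zero_add] at this
        simpa [Fin.forall_fin_succ, Simp.ofMem] using this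
  have : |H S| ≤ 0 := ge_of_tendsto' (hw.tendsto_zero S) key
  exact abs_nonpos_iff.1 this

/-- Four tetrahedra on the vertices and the midpoints of the sides express the triangle through its
pieces, the triangles lying on a side being flat. -/
theorem IsRegular.triSum_extend {H : Germ D 2} (hH : IsRegular H) (S : Simp D 2) {p q r : E d}
    (hp : p ∈ convexHull ℝ (Set.range S.1)) (hq : q ∈ convexHull ℝ (Set.range S.1))
    (hr : r ∈ convexHull ℝ (Set.range S.1)) :
    triSum (fun p q r => extend H ![p, q, r]) p q r = extend H ![p, q, r] := by
  have hK := convex_convexHull ℝ (Set.range S.1)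
  have closed : ∀ a b c e : E d, a ∈ convexHull ℝ (Set.range S.1) →
      b ∈ convexHull ℝ (Set.range S.1) → c ∈ convexHull ℝ (Set.range S.1) →
      e ∈ convexHull ℝ (Set.range S.1) → extend H ![b, c, e] - extend H ![a, c, e] +
        extend H ![a, b, e] - extend H ![a, b, c] = 0 := by
    intro a b c e ha hb hc he
    have hmem : ∀ i, ![a, b, c, e] i ∈ convexHull ℝ (Set.range S.1) := by
      simpa [Fin.forall_fin_succ] using ⟨ha, hb, hc, he⟩
    have := hH.2.delta_eq_zero S (Simp.ofMem hK S.2 _ hmem) hmem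
    rw [delta_apply_two] at this
    simpa only [Simp.ofMem, Matrix.cons_val] using this
  have flat : ∀ a b c : E d, a ∈ convexHull ℝ (Set.range S.1) →
      b ∈ convexHull ℝ (Set.range S.1) → c ∈ convexHull ℝ (Set.range S.1) →
      Collinear ℝ {a, b, c} → extend H ![a, b, c] = 0 := by
    intro a b c ha hb hc h
    have hmem : ∀ i, ![a, b, c] i ∈ convexHull ℝ (Set.range S.1) := by
      simpa [Fin.forall_fin_succ] using ⟨ha, hb, hc⟩
    have e := extend_apply H (Simp.ofMem hK S.2 _ hmem)
    simp only [Simp.ofMem] at e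
    rw [e]
    exact hH.1 _ (Simp.vol_eq_zero_of_collinear _ h)
  have flat_mid : ∀ a b : E d, Collinear ℝ {a, midpoint ℝ a b, b} := fun a b =>
    (wbtw_midpoint ℝ a b).collinear
  have ha := hK.midpoint_mem hp hq
  have hm := hK.midpoint_mem hq hr
  have hc := hK.midpoint_mem hp hr
  have flat_self : ∀ a b : E d, a ∈ convexHull ℝ (Set.range S.1) →
      b ∈ convexHull ℝ (Set.range S.1) → extend H ![a, b, a] = 0 := fun a b ha hb =>
    flat a b a ha hb ha (by simp [collinear_pair])
  have flat_self' : ∀ a b : E d, a ∈ convexHull ℝ (Set.range S.1) →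
      b ∈ convexHull ℝ (Set.range S.1) → extend H ![a, a, b] = 0 := fun a b ha hb =>
    flat a a b ha ha hb (by simp [collinear_pair])
  have h1 := closed _ _ _ _ hp ha hq hr
  have h2 := closed _ _ _ _ hp ha hc hr
  have h3 := closed _ _ _ _ ha hq hm hr
  have h4 := closed _ _ _ _ ha hc hm hr
  -- Tetrahedra with a repeated vertex: these two give the alternation needed for the central piece.
  have h5 := closed _ _ _ _ ha hc hm ha
  have h6 := closed _ _ _ _ hm hc hm ha
  have f1 := flat _ _ _ hp ha hq (flat_mid p q)
  have f2 := flat _ _ _ hp hc hr (flat_mid p r)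
  have f3 := flat _ _ _ hq hm hr (flat_mid q r)
  have f4 := flat_self _ _ ha hm
  have f5 := flat_self _ _ ha hc
  have f6 := flat_self _ _ hm hc
  have f7 := flat_self' _ _ hm ha
  rw [triSum]
  linarith

theorem eq_zero_of_le_isDiniGauge_two {H w : Germ D 2} (hH : IsRegular H)
    (hw : IsDiniGauge (2 : ℕ) w) (hHw : ∀ S, |H S| ≤ w S) : H = 0 := by
  funext S
  have hK := convex_convexHull ℝ (Set.range S.1)
  have hS : (S.1 0, S.1 1, S.1 2) ∈ convexHull ℝ (Set.range S.1) ×ˢ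
      convexHull ℝ (Set.range S.1) ×ˢ convexHull ℝ (Set.range S.1) :=
    ⟨S.mem_convexHull 0, S.mem_convexHull 1, S.mem_convexHull 2⟩
  have key : ∀ n : ℕ, |H S| ≤ 2 ^ ((n : ℝ) * (2 : ℕ)) * w (S.shrink n) := by
    intro n
    have := abs_refine_iterate_le (s := triPiece)
      (ω := fun x : E d × E d × E d => extend H ![x.1, x.2.1, x.2.2])
      (Q := fun n => {y | y ∈ convexHull ℝ (Set.range S.1) ×ˢ convexHull ℝ (Set.range S.1) ×ˢ
        convexHull ℝ (Set.range S.1) ∧ ∃ u : ℝ, |u| = (1 / 2 : ℝ) ^ n ∧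
          y.2.1 - y.1 = u • (S.1 1 - S.1 0) ∧ y.2.2 - y.1 = u • (S.1 2 - S.1 0)})
      (w := w (S.shrink n))
      (fun k i y hy => ⟨triPiece_mem hK i hy.1, ?_⟩) n 0 (fun y hy => ?_)
      (x := (S.1 0, S.1 1, S.1 2)) ⟨hS, 1, by simp⟩
    · rw [refine_iterate_eq_of_refine_eq (isSubdivision_triPiece hK).mem (fun x hx => by
        rw [refine_triPiece (fun p q r => extend H ![p, q, r])]
        exact hH.triSum_extend S hx.1 hx.2.1 hx.2.2) n hS] at this
      have e : ![S.1 0, S.1 1, S.1 2] = S.1 := by funext i; fin_cases i <;> rfl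
      rw [e, extend_apply] at this
      refine this.trans (le_of_eq ?_)
      rw [mul_comm (n : ℝ), Real.rpow_mul (by norm_num), Real.rpow_natCast, Real.rpow_natCast]
      norm_num
    · obtain ⟨-, u, hu, h1, h2⟩ := hy
      obtain ⟨v, hv, h3, h4⟩ := triPiece_homothetic i y
      refine ⟨v * u, ?_, ?_, ?_⟩
      · rw [abs_mul, hv, hu, pow_succ, mul_comm]
      · rw [h3, h1, smul_smul]
      · rw [h4, h2, smul_smul]
    · obtain ⟨hyK, u, hu, h1, h2⟩ := hy
      have hmem : ∀ i, ![y.1, y.2.1, y.2.2] i ∈ convexHull ℝ (Set.range S.1) := by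
        simpa [Fin.forall_fin_succ] using hyK
      have e := extend_apply H (Simp.ofMem hK S.2 _ hmem)
      simp only [Simp.ofMem] at e
      rw [zero_add] at hu
      rw [e, hw.uniform _ _ (S.isometric_shrink (Simp.ofMem hK S.2 _ hmem) n hu ?_)]
      · exact hHw _
      · simpa [Fin.forall_fin_succ, Simp.ofMem] using ⟨h1, h2⟩
  have : |H S| ≤ 0 := ge_of_tendsto' (hw.tendsto_zero S) key
  exact abs_nonpos_iff.1 this

/-- The two gauges may differ, but a sum of nonnegative multiples of Dini gauges is again one; this
makes uniqueness independent of the gauge. -/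
theorem IsSew.exists_gauge {k : ℕ} {ω η η' : Germ D k} (h : IsSew ω η) (h' : IsSew ω η') :
    ∃ w : Germ D k, IsDiniGauge k w ∧ ∀ S, |(η - η') S| ≤ w S := by
  obtain ⟨-, v, hv, hb⟩ := h
  obtain ⟨-, v', hv', hb'⟩ := h'
  refine ⟨_, (hv.const_mul (c := (bracket v (ω - η)).toReal) ENNReal.toReal_nonneg).add
    (hv'.const_mul (c := (bracket v' (ω - η')).toReal) ENNReal.toReal_nonneg), fun S => ?_⟩
  have h1 := abs_le_toReal_bracket hv.nonneg hb S
  have h2 := abs_le_toReal_bracket hv'.nonneg hb' S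
  simp only [Pi.sub_apply, Pi.add_apply] at *
  rw [abs_le] at *
  constructor <;> linarith [h1.1, h1.2, h2.1, h2.2]

theorem IsSew.unique_one {ω η η' : Germ D 1} (h : IsSew ω η) (h' : IsSew ω η') : η = η' := by
  obtain ⟨w, hw, hle⟩ := h.exists_gauge h'
  exact sub_eq_zero.1 (eq_zero_of_le_isDiniGauge_one (h.1.sub h'.1) hw hle)

theorem IsSew.unique_two {ω η η' : Germ D 2} (h : IsSew ω η) (h' : IsSew ω η') : η = η' := by
  obtain ⟨w, hw, hle⟩ := h.exists_gauge h'
  exact sub_eq_zero.1 (eq_zero_of_le_isDiniGauge_two (h.1.sub h'.1) hw hle)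

theorem isSew_sew {k : ℕ} {ω : Germ D k} (h : ∃ η, IsSew ω η) : IsSew ω (sew ω) := by
  rw [sew, dif_pos h]
  exact h.choose_spec

end Uniqueness

end

section

open Filter Topology
open scoped NNReal ENNReal

variable {d : ℕ} {D K : Set (E d)}

/-! ### The germs `g₁ dg₂` and `f dg₁ ∧ dg₂`. -/

section Integral

/-- The `1`-germ defined by a function of two points. -/
def segGerm (D : Set (E d)) (η : E d → E d → ℝ) : Germ D 1 := fun S => η (S.1 0) (S.1 1)

/-- The `2`-germ defined by a function of three points. -/
def triGerm (D : Set (E d)) (F : E d → E d → E d → ℝ) : Germ D 2 :=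
  fun S => F (S.1 0) (S.1 1) (S.1 2)

theorem delta_segGerm (η : E d → E d → ℝ) (T : Simp D 2) :
    delta (segGerm D η) T = coboundary η (T.1 0) (T.1 1) (T.1 2) := by
  rw [delta, Fin.sum_univ_three]
  change (-1 : ℝ) ^ 0 * η (T.1 1) (T.1 2) + (-1) ^ 1 * η (T.1 0) (T.1 2) +
    (-1) ^ 2 * η (T.1 0) (T.1 1) = _
  rw [coboundary]
  ring

theorem delta_triGerm (F : E d → E d → E d → ℝ) (T : Simp D 3) :
    delta (triGerm D F) T = F (T.1 1) (T.1 2) (T.1 3) - F (T.1 0) (T.1 2) (T.1 3) +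
      F (T.1 0) (T.1 1) (T.1 3) - F (T.1 0) (T.1 1) (T.1 2) := by
  rw [delta, Fin.sum_univ_four]
  change (-1 : ℝ) ^ 0 * F (T.1 1) (T.1 2) (T.1 3) + (-1) ^ 1 * F (T.1 0) (T.1 2) (T.1 3) +
    (-1) ^ 2 * F (T.1 0) (T.1 1) (T.1 3) + (-1) ^ 3 * F (T.1 0) (T.1 1) (T.1 2) = _
  ring

theorem delta_pullback {n k : ℕ} {I : Set (E n)} (φ : E n →ᵃ[ℝ] E d) (h : Set.MapsTo φ I D)
    (ω : Germ D k) (T : Simp I (k + 1)) : delta (pullback φ h ω) T = delta ω (T.map φ h) :=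
  rfl

theorem cup_zero_one_apply (f : Germ D 0) (ω : Germ D 1) (S : Simp D 1) :
    cup (k := 0) (h := 1) f ω S = extend f ![S.1 0] * ω S := by
  have h1 : (S.sub fun i : Fin 1 => ⟨(i : ℕ), by omega⟩).1 = ![S.1 0] := by
    funext i; fin_cases i; rfl
  have h2 : (S.sub fun i : Fin 2 => ⟨0 + (i : ℕ), by omega⟩) = S := by
    refine Subtype.ext (funext fun i => ?_)
    fin_cases i <;> rfl
  rw [← h1, extend_apply]
  change f _ * ω (S.sub fun i : Fin 2 => ⟨0 + (i : ℕ), by omega⟩) = _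
  rw [h2]

theorem cup_zero_two_apply (f : Germ D 0) (ω : Germ D 2) (S : Simp D 2) :
    cup (k := 0) (h := 2) f ω S = extend f ![S.1 0] * ω S := by
  have h1 : (S.sub fun i : Fin 1 => ⟨(i : ℕ), by omega⟩).1 = ![S.1 0] := by
    funext i; fin_cases i; rfl
  have h2 : (S.sub fun i : Fin 3 => ⟨0 + (i : ℕ), by omega⟩) = S := by
    refine Subtype.ext (funext fun i => ?_)
    fin_cases i <;> rfl
  rw [← h1, extend_apply]
  change f _ * ω (S.sub fun i : Fin 3 => ⟨0 + (i : ℕ), by omega⟩) = _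
  rw [h2]

theorem cup_one_one_apply (g₁ g₂ : Germ D 0) (S : Simp D 2) :
    cup (delta g₁) (delta g₂) S = (extend g₁ ![S.1 1] - extend g₁ ![S.1 0]) *
      (extend g₂ ![S.1 2] - extend g₂ ![S.1 1]) := by
  change delta g₁ (S.sub fun i : Fin 2 => ⟨(i : ℕ), by omega⟩) *
    delta g₂ (S.sub fun i : Fin 2 => ⟨1 + (i : ℕ), by omega⟩) = _
  rw [delta_apply_zero, delta_apply_zero]
  rfl

/-- The function of segments defined by `g₁ ∪ δg₂`. -/
noncomputable def segFun (g₁ g₂ : Germ D 0) (p q : E d) : ℝ :=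
  extend g₁ ![p] * (extend g₂ ![q] - extend g₂ ![p])

theorem cup_delta_eq_segGerm (g₁ g₂ : Germ D 0) :
    cup (k := 0) (h := 1) g₁ (delta g₂) = segGerm D (segFun g₁ g₂) := by
  funext S
  rw [cup_zero_one_apply, delta_apply_zero]
  rfl

/-- The coboundary of `segFun g₁ g₂` is the product of increments `δg₁ ∪ δg₂`; no Hölder bound on
either function alone is needed. -/
theorem isAlmostClosed_segFun {g₁ g₂ : Germ D 0} {β B : ℝ} (hβ : 1 < β) (hB : 0 ≤ B)
    (h₁ : Continuous g₁) (h₂ : Continuous g₂)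
    (hle : ∀ S, |cup (delta g₁) (delta g₂) S| ≤ B * S.diam ^ β)
    (hK : Convex ℝ K) (hKD : K ⊆ D) : IsAlmostClosed K β B (segFun g₁ g₂) where
  convex := hK
  one_lt := hβ
  const_nonneg := hB
  cont := by
    have c1 := (continuousOn_extend h₁).mono hKD
    have c2 := (continuousOn_extend h₂).mono hKD
    have m1 : Set.MapsTo Prod.fst (K ×ˢ K) K := fun x hx => hx.1
    have m2 : Set.MapsTo Prod.snd (K ×ˢ K) K := fun x hx => hx.2
    exact (c1.comp continuousOn_fst m1).mul
      ((c2.comp continuousOn_snd m2).sub (c2.comp continuousOn_fst m1))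
  le p hp q hq r hr ε hpq hqr hpr := by
    have hε : 0 ≤ ε := dist_nonneg.trans hpq
    have hmem : ∀ i, ![p, q, r] i ∈ K := by
      simpa [Fin.forall_fin_succ] using ⟨hp, hq, hr⟩
    have h := hle (Simp.ofMem hK hKD _ hmem)
    have hd : (Simp.ofMem hK hKD _ hmem).diam ≤ ε := by
      refine Simp.diam_le _ hε ?_
      simp [Fin.forall_fin_succ, Simp.ofMem, hpq, hqr, hpr, hε, dist_comm q p, dist_comm r p,
        dist_comm r q]
    rw [cup_one_one_apply] at h
    simp only [Simp.ofMem, Matrix.cons_val] at h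
    have e : coboundary (segFun g₁ g₂) p q r = (extend g₁ ![q] - extend g₁ ![p]) *
        (extend g₂ ![r] - extend g₂ ![q]) := by
      simp only [coboundary, segFun]
      ring
    rw [e]
    refine h.trans ?_
    have hβ0 : 0 ≤ β := by linarith
    have := Simp.diam_nonneg (Simp.ofMem hK hKD _ hmem)
    gcongr
    exact hd

theorem IsAlmostClosed.isAreaPair {f : Germ D 0} {α β A B : ℝ} {ω : E d → E d → ℝ}
    (h : IsAlmostClosed K β B ω) (hα : 0 < α) (hαβ : 2 < α + β) (hA : 0 ≤ A) (hf : Continuous f)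
    (hle : ∀ S, |delta f S| ≤ A * S.diam ^ α) (hKD : K ⊆ D) :
    IsAreaPair K α β A (B * (1 + 3 * sewConst 2 β)) (fun x => extend f ![x]) (sewSeg ω) where
  convex := h.convex
  pos := hα
  nonneg := by linarith [h.one_lt]
  two_lt := hαβ
  holderConst_nonneg := hA
  const_nonneg := by
    have := h.const_nonneg
    have := h.sewConst_nonneg
    positivity
  cont := (continuousOn_extend hf).mono hKD
  holder p hp q hq := by
    have hmem : ∀ i, ![q, p] i ∈ K := by
      simpa [Fin.forall_fin_succ] using ⟨hq, hp⟩
    have h1 := hle (Simp.ofMem h.convex hKD _ hmem)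
    have hd : (Simp.ofMem h.convex hKD _ hmem).diam ≤ dist p q := by
      refine Simp.diam_le _ dist_nonneg ?_
      simp [Fin.forall_fin_succ, Simp.ofMem, dist_comm q p]
    rw [delta_apply_zero] at h1
    refine h1.trans ?_
    have := Simp.diam_nonneg (Simp.ofMem h.convex hKD _ hmem)
    gcongr
  cont_seg := h.continuousOn_sewSeg
  midpoint_add _ hp _ hq := h.sewSeg_midpoint_add hp hq
  swap _ hp _ hq := h.sewSeg_swap hp hq
  eq_zero _ hp _ hq _ hr := h.coboundary_sewSeg_eq_zero hp hq hr
  le _ hp _ hq _ hr _ := h.coboundary_sewSeg_le hp hq hr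

/-- `sewSeg ω` does not refer to `K`, so each simplex can be treated in its own hull. Three points
of `ℝ` are collinear, and affine maps keep them so. -/
theorem isRegular_segGerm {β B : ℝ} {ω : E d → E d → ℝ}
    (h : ∀ K : Set (E d), Convex ℝ K → K ⊆ D → IsAlmostClosed K β B ω) :
    IsRegular (segGerm D (sewSeg ω)) := by
  refine ⟨fun S hS => ?_, fun I φ hI => funext fun T => ?_⟩
  · rw [segGerm, S.eq_of_vol_eq_zero hS]
    exact (h _ (convex_convexHull ℝ _) S.2).sewSeg_self (S.mem_convexHull 0)
  · rw [delta_pullback, delta_segGerm]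
    refine (h _ (convex_convexHull ℝ _) (T.map φ hI).2).coboundary_sewSeg_eq_zero
      (Simp.mem_convexHull _ 0) (Simp.mem_convexHull _ 1) (Simp.mem_convexHull _ 2) ?_
    have hc : Collinear ℝ {T.1 0, T.1 1, T.1 2} := by
      rw [collinear_iff_finrank_le_one]
      exact (Submodule.finrank_le _).trans (by simp)
    obtain ⟨o, v, hv⟩ := (collinear_iff_exists_forall_eq_smul_vadd (k := ℝ) _).1 hc
    refine (collinear_iff_exists_forall_eq_smul_vadd (k := ℝ) _).2 ⟨φ o, φ.linear v, ?_⟩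
    have key : ∀ i, T.1 i ∈ ({T.1 0, T.1 1, T.1 2} : Set (E 1)) →
        ∃ r : ℝ, (T.map φ hI).1 i = r • φ.linear v +ᵥ φ o := by
      intro i hi
      obtain ⟨r, hr⟩ := hv _ hi
      refine ⟨r, ?_⟩
      change φ (T.1 i) = _
      rw [hr, AffineMap.map_vadd, map_smul]
    rintro _ (rfl | rfl | rfl)
    exacts [key 0 (by simp), key 1 (by simp), key 2 (by simp)]

theorem isRegular_triGerm {α β A B : ℝ} {f : E d → ℝ} {η : E d → E d → ℝ}
    (h : ∀ K : Set (E d), Convex ℝ K → K ⊆ D → IsAreaPair K α β A B f η) :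
    IsRegular (triGerm D (sewTri f η)) := by
  refine ⟨fun S hS => ?_, fun I φ hI => funext fun T => ?_⟩
  · exact (h _ (convex_convexHull ℝ _) S.2).sewTri_collinear (S.mem_convexHull 0)
      (S.mem_convexHull 1) (S.mem_convexHull 2) (S.collinear_of_vol_eq_zero hS)
  · rw [delta_pullback, delta_triGerm]
    refine (h _ (convex_convexHull ℝ _) (T.map φ hI).2).sewTri_closed
      (fun i => Simp.mem_convexHull _ i) fun hind => ?_
    -- Independent images would come from four independent points of the plane.
    have h2 : AffineIndependent ℝ T.1 := AffineIndependent.of_comp φ hind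
    have h3 := h2.card_le_finrank_succ
    have h4 := Submodule.finrank_le (vectorSpan ℝ (Set.range T.1))
    simp at h3 h4
    omega

theorem segGerm_sub_le {β B : ℝ} {ω : E d → E d → ℝ}
    (h : ∀ K : Set (E d), Convex ℝ K → K ⊆ D → IsAlmostClosed K β B ω) (S : Simp D 1) :
    |(segGerm D ω - segGerm D (sewSeg ω)) S| ≤ B * sewConst 2 β * diamPow D 1 β S := by
  have hS := h _ (convex_convexHull ℝ _) S.2
  refine (hS.abs_sub_sewSeg_le (S.mem_convexHull 0) (S.mem_convexHull 1)).trans ?_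
  have := hS.const_nonneg
  have := hS.sewConst_nonneg
  have hβ : 0 ≤ β := by linarith [hS.one_lt]
  exact mul_le_mul_of_nonneg_left (Real.rpow_le_rpow dist_nonneg (S.dist_le_diam 0 1) hβ)
    (by positivity)

theorem cup_delta_segGerm_sub_le {f : Germ D 0} {α β A B : ℝ} {η : E d → E d → ℝ}
    (h : ∀ K : Set (E d), Convex ℝ K → K ⊆ D →
      IsAreaPair K α β A B (fun x => extend f ![x]) η) (S : Simp D 2) :
    |(cup (k := 0) (h := 2) f (delta (segGerm D η)) -
      triGerm D (sewTri (fun x => extend f ![x]) η)) S| ≤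
      3 * (A * B) * sewConst 4 (α + β) * diamPow D 2 (α + β) S := by
  rw [Pi.sub_apply, cup_zero_two_apply, delta_segGerm]
  exact (h _ (convex_convexHull ℝ _) S.2).abs_sub_sewTri_le (S.mem_convexHull 0)
    (S.mem_convexHull 1) (S.mem_convexHull 2) (S.dist_le_diam 0 1) (S.dist_le_diam 1 2)
    (S.dist_le_diam 0 2)

theorem bracket_le_ofReal {k : ℕ} {v ω : Germ D k} {c : ℝ} (hv : ∀ S, 0 ≤ v S)
    (h : ∀ S, |ω S| ≤ c * v S) : bracket v ω ≤ ENNReal.ofReal c :=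
  bracket_le c.toNNReal fun S =>
    (h S).trans (mul_le_mul_of_nonneg_right (Real.le_coe_toNNReal c) (hv S))

end Integral

end

end RoughForm

/-! ### The main theorem. -/

open RoughForm
theorem mainTheorem6 (α β : ℝ) (hα : 0 < α) (hβ : 1 < β) (hαβ : 2 < α + β) :
    ∃ C : ℝ≥0, ∀ (d : ℕ) (D : Set (RoughForm.E d)) (f g₁ g₂ : Germ D 0),
      Continuous f → Continuous g₁ → Continuous g₂ →
      bracketPow α (delta f) + bracketPow β (cup (delta g₁) (delta g₂)) < ∞ →
      -- the germ `g₁ dg₂` is well defined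
      (∃! η : Germ D 1, IsSew (cup g₁ (delta g₂)) η) ∧
      -- the germ `f ∪ δ(g₁ dg₂)` is `(α + β)`-sewable
      IsSewableWith (diamPow D 2 (α + β)) (cup f (delta (sewD g₁ g₂))) ∧
      -- the germ `f dg₁ ∧ dg₂` is well defined
      (∃! ω : Germ D 2, IsSew (cup f (delta (sewD g₁ g₂))) ω) ∧
      -- the error bound
      bracketPow (α + β) (cup f (delta (sewD g₁ g₂)) - sewD f (sewD g₁ g₂)) ≤
        C * bracketPow α (delta f) * bracketPow β (cup (delta g₁) (delta g₂)) := by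
  -- The factor `1 + 3 * sewConst 2 β` is the loss in the coboundary bound when `g₁ ∪ δg₂` is
  -- replaced by its sewing; the rest is the sewing error on triangles.
  refine ⟨(3 * (1 + 3 * sewConst 2 β) * sewConst 4 (α + β)).toNNReal, ?_⟩
  intro d D f g₁ g₂ hf hg₁ hg₂ hfin
  obtain ⟨hfA, hgB⟩ := ENNReal.add_lt_top.1 hfin
  set A := (bracketPow α (delta f)).toReal with hA
  set B := (bracketPow β (cup (delta g₁) (delta g₂))).toReal with hB
  have hA0 : 0 ≤ A := ENNReal.toReal_nonneg
  have hB0 : 0 ≤ B := ENNReal.toReal_nonneg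
  have leA : ∀ S, |delta f S| ≤ A * S.diam ^ α :=
    abs_le_toReal_bracket (diamPow_nonneg _ α) hfA
  have leB : ∀ S, |cup (delta g₁) (delta g₂) S| ≤ B * S.diam ^ β :=
    abs_le_toReal_bracket (diamPow_nonneg _ β) hgB
  have closed : ∀ K : Set (E d), Convex ℝ K → K ⊆ D → IsAlmostClosed K β B (segFun g₁ g₂) :=
    fun K hK hKD => isAlmostClosed_segFun hβ hB0 hg₁ hg₂ leB hK hKD
  have area : ∀ K : Set (E d), Convex ℝ K → K ⊆ D → IsAreaPair K α β A
      (B * (1 + 3 * sewConst 2 β)) (fun x => extend f ![x]) (sewSeg (segFun g₁ g₂)) :=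
    fun K hK hKD => (closed K hK hKD).isAreaPair hα hαβ hA0 hf leA hKD
  have sew₁ : IsSew (cup (k := 0) (h := 1) g₁ (delta g₂))
      (segGerm D (sewSeg (segFun g₁ g₂))) := by
    refine ⟨isRegular_segGerm closed, diamPow D 1 β,
      isDiniGauge_diamPow (by simpa using hβ) (by linarith), ?_⟩
    rw [cup_delta_eq_segGerm]
    exact (bracket_le_ofReal (diamPow_nonneg 1 β) (segGerm_sub_le closed)).trans_lt
      ENNReal.ofReal_lt_top
  -- `sew` is an arbitrary choice; uniqueness identifies it with the explicit limit.
  have hsewD : sewD g₁ g₂ = segGerm D (sewSeg (segFun g₁ g₂)) :=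
    IsSew.unique_one (isSew_sew ⟨_, sew₁⟩) sew₁
  have dini : IsDiniGauge (2 : ℕ) (diamPow D 2 (α + β)) :=
    isDiniGauge_diamPow (by simpa using hαβ) (by linarith)
  have bound := bracket_le_ofReal (diamPow_nonneg 2 (α + β)) (cup_delta_segGerm_sub_le area)
  have sew₂ : IsSew (cup (k := 0) (h := 2) f (delta (sewD g₁ g₂)))
      (triGerm D (sewTri (fun x => extend f ![x]) (sewSeg (segFun g₁ g₂)))) := by
    refine ⟨isRegular_triGerm area, diamPow D 2 (α + β), dini, ?_⟩
    rw [hsewD]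
    exact bound.trans_lt ENNReal.ofReal_lt_top
  have hsewD₂ : sewD f (sewD g₁ g₂) =
      triGerm D (sewTri (fun x => extend f ![x]) (sewSeg (segFun g₁ g₂))) :=
    IsSew.unique_two (isSew_sew ⟨_, sew₂⟩) sew₂
  refine ⟨⟨_, sew₁, fun η hη => IsSew.unique_one hη sew₁⟩, ⟨dini, _, sew₂.1, ?_⟩,
    ⟨_, sew₂, fun ω hω => IsSew.unique_two hω sew₂⟩, ?_⟩
  · rw [hsewD]
    exact bound.trans_lt ENNReal.ofReal_lt_top
  · rw [hsewD₂, hsewD]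
    refine bound.trans (le_of_eq ?_)
    have hs₂ : 0 ≤ sewConst 2 β := sewConst_nonneg (by simpa using two_lt_rpow hβ)
    have hs₄ : 0 ≤ sewConst 4 (α + β) := sewConst_nonneg (by simpa using four_lt_rpow hαβ)
    rw [← ENNReal.ofReal_toReal hfA.ne, ← ENNReal.ofReal_toReal hgB.ne, ← hA, ← hB,
      ENNReal.ofNNReal_toNNReal, ← ENNReal.ofReal_mul (by positivity),
      ← ENNReal.ofReal_mul (by positivity)]
    congr 1
    ring
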